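/- Let $\mathbb T$ be the unit circle with normalized Lebesgue measure, let $\mathbb M_{m,n}$ be the space of complex $m\times n$ matrices with the operator norm (with respect to the Euclidean norms of $\mathbb C^n$ and $\mathbb C^m$), and for $\Phi\in L^\infty(\mathbb M_{m,n})$ put $\|\Phi\|_\infty=\operatorname{ess\,sup}_{\zeta\in\mathbb T}\|\Phi(\zeta)\|$. The Hardy spaces $H^2(\mathbb C^n)\subset L^2(\mathbb C^n)$ and $H^\infty(\mathbb M_{m,n})\subset L^\infty(\mathbb M_{m,n})$ consist of the functions on $\mathbb T$ whose Fourier coefficients with negative index vanish. Let $\mathbb P_+$ and $\mathbb P_-$ be the orthogonal projections of $L^2(\mathbb C^m)$ onto $H^2(\mathbb C^m)$ and onto $H^2_-(\mathbb C^m)=L^2(\mathbb C^m)\ominus H^2(\mathbb C^m)$. The Toeplitz and Hankel operators $T_\Phi:H^2(\mathbb C^n)\to H^2(\mathbb C^m)$ and $H_\Phi:H^2(\mathbb C^n)\to H^2_-(\mathbb C^m)$ are defined by $T_\Phi f=\mathbb P_+(\Phi f)$ and $H_\Phi f=\mathbb P_-(\Phi f)$. The essential norm of a bounded operator $A$ is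 $\|A\|_{\rm e}=\inf\{\|A-K\|: K\text{ compact}\}$. The function $\Phi$ is called badly approximable if $\|\Phi\|_\infty=\inf\{\|\Phi-F\|_\infty: F\in H^\infty(\mathbb M_{m,n})\}$. A maximizing vector of a matrix $A\in\mathbb M_{m,n}$ is a nonzero vector $x\in\mathbb C^n$ with $\|Ax\|=\|A\|\,\|x\|$. **Theorem 6.1.** Let $\Phi\in L^\infty(\mathbb M_{m,n})$, and consider the conditions (i) $\|\Phi(\zeta)\|$ is constant for almost all $\zeta\in\mathbb T$; (ii) there is a function $f\in\operatorname{Ker}T_\Phi$ such that $f(\zeta)$ is a maximizing vector of $\Phi(\zeta)$ for almost all $\zeta\in\mathbb T$. If $\|H_\Phi\|_{\rm e}<\|\Phi\|_\infty$, then $\Phi$ is badly approximable if and only if (i) and (ii) hold. Moreover, for every $\Phi\in L^\infty(\mathbb M_{m,n})$, whether or not $\|H_\Phi\|_{\rm e}<\|\Phi\|_\infty$, if (i) and (ii) hold then $\Phi$ is badly approximable. -/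

import Mathlib

open MeasureTheory
open scoped ENNReal Matrix.Norms.L2Operator

noncomputable section

namespace BadlyApprox

/-- The space `L^p(E)` of `E`-valued functions on the unit circle `𝕋`, with respect to normalized
Lebesgue measure. The circle is `ℝ / ℤ`, the class of `t` standing for `ζ = exp (2πit)`, so that
`fourier k` is the function `ζ ↦ ζ ^ k`. -/
abbrev LpCircle (E : Type) [NormedAddCommGroup E] (p : ℝ≥0∞) :=
  Lp E p (AddCircle.haarAddCircle (T := (1 : ℝ)))

section Hardy

theorem integrable_lpCircle {E : Type} [NormedAddCommGroup E] {p : ℝ≥0∞} [Fact (1 ≤ p)]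
    (f : LpCircle E p) : Integrable f (AddCircle.haarAddCircle (T := (1 : ℝ))) :=
  (Lp.memLp f).integrable Fact.out

variable {E : Type} [NormedAddCommGroup E] [NormedSpace ℂ E] {p : ℝ≥0∞} [Fact (1 ≤ p)]

variable (E p) in
/-- The Hardy space `H^p(E)`, as the space of boundary values on `𝕋`: the functions in `L^p(E)`
all of whose Fourier coefficients with negative index vanish. -/
def hardy : Submodule ℂ (LpCircle E p) where
  carrier := {f | ∀ k : ℤ, k < 0 → fourierCoeff f k = 0}
  zero_mem' k _ := by
    rw [fourierCoeff_congr_ae (Lp.coeFn_zero E p _)]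
    simp [fourierCoeff]
  add_mem' {f g} hf hg k hk := by
    rw [fourierCoeff_congr_ae (Lp.coeFn_add f g),
      fourierCoeff.add (integrable_lpCircle f) (integrable_lpCircle g),
      Pi.add_apply, hf k hk, hg k hk, add_zero]
  smul_mem' c f hf k hk := by
    rw [fourierCoeff_congr_ae (Lp.coeFn_smul c f), fourierCoeff.const_smul, hf k hk, smul_zero]

theorem mem_hardy {f : LpCircle E p} :
    f ∈ hardy E p ↔ ∀ k : ℤ, k < 0 → fourierCoeff f k = 0 := Iff.rfl

theorem norm_fourierCoeff_le (f : LpCircle E p) (k : ℤ) : ‖fourierCoeff f k‖ ≤ ‖f‖ := by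
  refine (norm_integral_le_integral_norm _).trans ?_
  have h : ∀ t : AddCircle (1 : ℝ), ‖fourier (-k) t • f t‖ = ‖f t‖ := fun t => by
    rw [norm_smul, fourier_apply, Circle.norm_coe, one_mul]
  simp_rw [h]
  rw [integral_norm_eq_lintegral_enorm (Lp.aestronglyMeasurable f), Lp.norm_def,
    ← eLpNorm_one_eq_lintegral_enorm]
  exact ENNReal.toReal_mono (Lp.eLpNorm_ne_top f)
    (eLpNorm_le_eLpNorm_of_exponent_le Fact.out (Lp.aestronglyMeasurable f))

theorem isClosed_hardy : IsClosed (hardy E p : Set (LpCircle E p)) := by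
  have hc : ∀ k : ℤ, Continuous fun f : LpCircle E p => fourierCoeff f k := fun k => by
    refine (LipschitzWith.of_dist_le_mul (K := 1) fun f g => ?_).continuous
    have h : fourierCoeff (f - g : LpCircle E p) k = fourierCoeff f k - fourierCoeff g k := by
      rw [eq_sub_iff_add_eq, ← Pi.add_apply (fourierCoeff (f - g : LpCircle E p)),
        ← fourierCoeff.add (integrable_lpCircle _) (integrable_lpCircle _),
        ← fourierCoeff_congr_ae (Lp.coeFn_add _ _), sub_add_cancel]
    rw [dist_eq_norm, dist_eq_norm, ← h, NNReal.coe_one, one_mul]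
    exact norm_fourierCoeff_le _ k
  have hs : (hardy E p : Set (LpCircle E p))
      = ⋂ k : ℤ, ⋂ _ : k < 0, {f : LpCircle E p | fourierCoeff f k = 0} := by
    ext f
    simp only [SetLike.mem_coe, mem_hardy, Set.mem_iInter, Set.mem_ofPred_eq]
  rw [hs]
  exact isClosed_iInter fun k => isClosed_iInter fun _ => isClosed_eq (hc k) continuous_const

instance [CompleteSpace E] : CompleteSpace (hardy E p) :=
  isClosed_hardy.isComplete.completeSpace_coe

end Hardy

/-- The space `𝕄_{m,n}` of complex `m × n` matrices, with the operator norm coming from the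
Euclidean norms of `ℂⁿ` and `ℂᵐ`. -/
abbrev Mat (m n : ℕ) := Matrix (Fin m) (Fin n) ℂ

/-- `ℂⁿ` with its Euclidean norm. -/
abbrev Vec (n : ℕ) := EuclideanSpace ℂ (Fin n)

/-- The action `(A, x) ↦ A x` of matrices on vectors, as a continuous bilinear map. -/
def matAct (m n : ℕ) : Mat m n →L[ℂ] Vec n →L[ℂ] Vec m :=
  LinearMap.toContinuousLinearMap
    (Matrix.toEuclideanLin.trans LinearMap.toContinuousLinearMap).toLinearMap

theorem matAct_apply {m n : ℕ} (A : Mat m n) (x : Vec n) :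
    matAct m n A x = WithLp.toLp 2 (Matrix.mulVec A x.ofLp) := rfl

theorem norm_matAct {m n : ℕ} (A : Mat m n) : ‖matAct m n A‖ = ‖A‖ := rfl

/-- `x` is a maximizing vector of `A`: it is nonzero, and `‖A x‖ = ‖A‖ ‖x‖`. -/
def IsMaximizing {m n : ℕ} (A : Mat m n) (x : Vec n) : Prop :=
  x ≠ 0 ∧ ‖matAct m n A x‖ = ‖A‖ * ‖x‖

/-- Multiplication `f ↦ Φ f` by `Φ ∈ L^∞(𝕄_{m,n})`, from `L²(ℂⁿ)` to `L²(ℂᵐ)`. -/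
def mulOp {m n : ℕ} (Φ : LpCircle (Mat m n) ∞) :
    LpCircle (Vec n) 2 →L[ℂ] LpCircle (Vec m) 2 :=
  (matAct m n).holderL AddCircle.haarAddCircle ∞ 2 2 Φ

theorem coeFn_mulOp {m n : ℕ} (Φ : LpCircle (Mat m n) ∞) (f : LpCircle (Vec n) 2) :
    ∀ᵐ ζ ∂(AddCircle.haarAddCircle (T := (1 : ℝ))), mulOp Φ f ζ = matAct m n (Φ ζ) (f ζ) :=
  (matAct m n).coeFn_holder Φ f

/-- The Toeplitz operator `T_Φ : H²(ℂⁿ) → H²(ℂᵐ)`, `T_Φ f = ℙ₊ (Φ f)`. -/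
def toeplitz {m n : ℕ} (Φ : LpCircle (Mat m n) ∞) :
    hardy (Vec n) 2 →L[ℂ] hardy (Vec m) 2 :=
  (hardy (Vec m) 2).orthogonalProjectionOnto ∘L mulOp Φ ∘L (hardy (Vec n) 2).subtypeL

/-- The Hankel operator `H_Φ : H²(ℂⁿ) → H²₋(ℂᵐ) = L²(ℂᵐ) ⊖ H²(ℂᵐ)`, `H_Φ f = ℙ₋ (Φ f)`. -/
def hankel {m n : ℕ} (Φ : LpCircle (Mat m n) ∞) :
    hardy (Vec n) 2 →L[ℂ] (hardy (Vec m) 2)ᗮ :=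
  (hardy (Vec m) 2)ᗮ.orthogonalProjectionOnto ∘L mulOp Φ ∘L (hardy (Vec n) 2).subtypeL

/-- The essential norm of a bounded operator: its distance to the compact operators. -/
def essNorm {E F : Type*} [NormedAddCommGroup E] [NormedSpace ℂ E] [NormedAddCommGroup F]
    [NormedSpace ℂ F] (A : E →L[ℂ] F) : ℝ :=
  ⨅ K : {K : E →L[ℂ] F // IsCompactOperator K}, ‖A - K‖

/-- `Φ ∈ L^∞(𝕄_{m,n})` is badly approximable if
`‖Φ‖_∞ = inf {‖Φ - F‖_∞ : F ∈ H^∞(𝕄_{m,n})}`. -/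
def BadlyApproximable {m n : ℕ} (Φ : LpCircle (Mat m n) ∞) : Prop :=
  ‖Φ‖ = ⨅ F : hardy (Mat m n) ∞, ‖Φ - F‖

/-- `‖Φ(ζ)‖` is constant almost everywhere. -/
def HasConstantNorm {m n : ℕ} (Φ : LpCircle (Mat m n) ∞) : Prop :=
  ∃ c : ℝ, ∀ᵐ ζ ∂(AddCircle.haarAddCircle (T := (1 : ℝ))), ‖Φ ζ‖ = c

/-- Some `f` in the kernel of `T_Φ` is such that `f(ζ)` is a maximizing vector of `Φ(ζ)` for
almost every `ζ`. -/
def HasMaximizingKernelFunction {m n : ℕ} (Φ : LpCircle (Mat m n) ∞) : Prop :=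
  ∃ f : hardy (Vec n) 2, toeplitz Φ f = 0 ∧
    ∀ᵐ ζ ∂(AddCircle.haarAddCircle (T := (1 : ℝ))),
      IsMaximizing (Φ ζ) ((f : LpCircle (Vec n) 2) ζ)

end BadlyApprox

end

/-!
If `f` in the kernel of `T_Φ` is maximizing for `Φ` almost everywhere and `‖Φ(ζ)‖` is constant,
then `Φ f` lies in `H²₋` and has norm `‖Φ‖ ‖f‖`. As `F f ∈ H²` for `F ∈ H^∞`, pairing `Φ f` with
`(Φ - F) f` gives `‖Φ‖ ≤ ‖Φ - F‖` (`badlyApproximable_of_hasMaximizingKernelFunction`).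

Conversely, let `Φ` be badly approximable with `‖H_Φ‖ₑ < ‖Φ‖`. By the matrix form of Nehari's
theorem (`exists_mem_hardy_norm_sub_le`) there is `F ∈ H^∞` with `‖Φ - F‖ ≤ ‖H_Φ‖`, so that
`‖Φ‖ = ‖H_Φ‖`. An operator whose essential norm is smaller than its norm attains its norm
(`exists_norm_eq_of_essNorm_lt`): modulo a compact operator, a maximizing sequence is Cauchy by the
parallelogram law. A maximizing vector `f` of `H_Φ` gives equality throughout
`‖H_Φ f‖ ≤ ‖Φ f‖ ≤ ‖Φ‖ ‖f‖`. The first equality says `T_Φ f = 0`, the second that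
`‖Φ(ζ) f(ζ)‖ = ‖Φ‖ ‖f(ζ)‖` almost everywhere. Since a nonzero function in `H²` vanishes almost
nowhere (`ae_ne_zero_of_mem_hardy`), this yields both conditions.

Nehari's theorem is proved by a coupling in the manner of Adamyan, Arov and Krein. For `s = ‖H_Φ‖`,
the Hankel operator defines a positive semidefinite form on `H² × H²₋`, and multiplication by `ζ`
acts isometrically from the pairs `(f, ζ⁻¹ g)` to the pairs `(ζ f, g)`. This partial isometry
extends to a contraction `W` of a Hilbert space (`exists_coupling`). The matrix entries of the
powers of `W`, and of its adjoint, between the two copies of the constants form a Laurent matrix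
whose diagonals of negative index are those of `Φ`. By the positivity of the Toeplitz kernel of a
contraction (`re_sum_inner_dilPow_nonneg`), its symbol `Ψ` satisfies
`s ‖x‖² + s ‖y‖² + 2 Re (ζ ⟨y, Ψ(ζ) x⟩) ≥ 0` for all `x` and `y`, that is, `‖Ψ(ζ)‖ ≤ s`, and
`F = Φ - Ψ` is in `H^∞`.
-/

namespace BadlyApprox

open Filter Topology ContinuousLinearMap
open scoped InnerProductSpace ComplexConjugate

/-- Normalized Lebesgue measure on the circle `ℝ / ℤ`. -/
local notation "𝔪" => AddCircle.haarAddCircle (T := (1 : ℝ))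

/-! ### Hilbert space operators -/

section Operators

/-- An operator between Hilbert spaces whose essential norm is less than its norm attains its
norm. -/
theorem exists_norm_eq_of_essNorm_lt {E F : Type*} [NormedAddCommGroup E] [InnerProductSpace ℂ E]
    [CompleteSpace E] [NormedAddCommGroup F] [InnerProductSpace ℂ F] {A : E →L[ℂ] F}
    (hA : essNorm A < ‖A‖) : ∃ x : E, ‖x‖ = 1 ∧ ‖A x‖ = ‖A‖ := by
  have : Nonempty {K : E →L[ℂ] F // IsCompactOperator K} := ⟨⟨0, isCompactOperator_zero⟩⟩
  obtain ⟨⟨K, hK⟩, hKA⟩ := exists_lt_of_ciInf_lt hA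
  simp only at hKA
  set a := ‖A - K‖ with ha
  have ha0 : 0 ≤ a := norm_nonneg _
  have hpos : 0 < ‖A‖ := ha0.trans_lt hKA
  -- a maximizing sequence of unit vectors
  have hseq : ∀ k : ℕ, ∃ x : E, ‖x‖ = 1 ∧ ‖A‖ - 1 / (k + 1) < ‖A x‖ := fun k => by
    have hlt : max (‖A‖ - 1 / ((k : ℝ) + 1)) 0 < ‖A‖ :=
      max_lt (sub_lt_self _ Nat.one_div_pos_of_nat) hpos
    obtain ⟨x, hx1, hx⟩ := A.exists_lt_apply_of_lt_opNorm hlt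
    have hx0 : x ≠ 0 := by
      rintro rfl
      simp at hx
    have hx' : 0 < ‖x‖ := norm_pos_iff.2 hx0
    refine ⟨(‖x‖⁻¹ : ℂ) • x, ?_, ?_⟩
    · rw [norm_smul, norm_inv, Complex.norm_real, norm_norm, inv_mul_cancel₀ hx'.ne']
    · rw [map_smul, norm_smul, norm_inv, Complex.norm_real, norm_norm]
      refine (le_max_left _ _).trans_lt (hx.trans_le ?_)
      exact le_mul_of_one_le_left (norm_nonneg _) ((one_le_inv₀ hx').2 hx1.le)
  choose x hx1 hxA using hseq
  obtain ⟨y, -, φ, hφ, hy⟩ := (hK.isCompact_closure_image_closedBall 1).tendsto_subseq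
    (x := fun k => K (x k))
    (fun k => subset_closure ⟨x k, by simp [hx1 k], rfl⟩)
  have hAlim : Tendsto (fun k => ‖A (x (φ k))‖) atTop (𝓝 ‖A‖) := by
    have h1 : Tendsto (fun k : ℕ => ‖A‖ - 1 / ((k : ℝ) + 1)) atTop (𝓝 ‖A‖) := by
      simpa using tendsto_const_nhds.sub (tendsto_one_div_add_atTop_nhds_zero_nat (𝕜 := ℝ))
    refine tendsto_of_tendsto_of_tendsto_of_le_of_le (h1.comp hφ.tendsto_atTop)
      tendsto_const_nhds (fun k => (hxA _).le) fun k => ?_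
    simpa [hx1] using A.le_opNorm (x (φ k))
  have hd : 0 < ‖A‖ ^ 2 - a ^ 2 := by nlinarith
  -- `A` nearly preserves the length `‖A‖ ‖x‖` of differences along the sequence, while `A - K`
  -- shrinks them: hence the sequence is Cauchy
  have key : ∀ k l, (‖A‖ ^ 2 - a ^ 2) * ‖x (φ k) - x (φ l)‖ ^ 2 ≤
      (4 * ‖A‖ ^ 2 - 2 * ‖A (x (φ k))‖ ^ 2 - 2 * ‖A (x (φ l))‖ ^ 2) +
      (4 * a * ‖K (x (φ k)) - K (x (φ l))‖ + ‖K (x (φ k)) - K (x (φ l))‖ ^ 2) := fun k l => by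
    set u := x (φ k)
    set v := x (φ l)
    have hu : ‖u‖ = 1 := hx1 _
    have hv : ‖v‖ = 1 := hx1 _
    have p1 := parallelogram_law_with_norm ℂ u v
    have p2 := parallelogram_law_with_norm ℂ (A u) (A v)
    rw [← map_add, ← map_sub] at p2
    rw [hu, hv] at p1
    have h1 : ‖A (u + v)‖ ≤ ‖A‖ * ‖u + v‖ := A.le_opNorm _
    have h2 : ‖A (u - v)‖ ≤ a * ‖u - v‖ + ‖K u - K v‖ := by
      have : A (u - v) = (A - K) (u - v) + (K u - K v) := by simp
      rw [this]
      exact (norm_add_le _ _).trans (add_le_add_left ((A - K).le_opNorm _) _)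
    have h3 : ‖u - v‖ ≤ 2 := (norm_sub_le _ _).trans (by rw [hu, hv]; norm_num)
    have h1' := pow_le_pow_left₀ (norm_nonneg _) h1 2
    have h2' := pow_le_pow_left₀ (norm_nonneg _) h2 2
    have h4 : a * ‖K u - K v‖ * ‖u - v‖ ≤ a * ‖K u - K v‖ * 2 :=
      mul_le_mul_of_nonneg_left h3 (by positivity)
    nlinarith
  have hcau : CauchySeq fun k => x (φ k) := by
    have hKd : Tendsto (fun p : ℕ × ℕ => ‖K (x (φ p.1)) - K (x (φ p.2))‖) atTop (𝓝 0) := by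
      have := ((hy.comp (tendsto_fst (g := atTop))).sub (hy.comp (tendsto_snd (f := atTop)))).norm
      rw [prod_atTop_atTop_eq] at this
      simpa using this
    have h1 : Tendsto (fun p : ℕ × ℕ => ‖A (x (φ p.1))‖) atTop (𝓝 ‖A‖) := by
      rw [← prod_atTop_atTop_eq]; exact hAlim.comp tendsto_fst
    have h2 : Tendsto (fun p : ℕ × ℕ => ‖A (x (φ p.2))‖) atTop (𝓝 ‖A‖) := by
      rw [← prod_atTop_atTop_eq]; exact hAlim.comp tendsto_snd
    have h3 := (((tendsto_const_nhds (x := 4 * ‖A‖ ^ 2)).sub ((h1.pow 2).const_mul 2)).sub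
      ((h2.pow 2).const_mul 2)).add ((hKd.const_mul (4 * a)).add (hKd.pow 2))
    have h4 : Tendsto (fun p : ℕ × ℕ => ‖x (φ p.1) - x (φ p.2)‖ ^ 2) atTop (𝓝 0) := by
      have h5 : Tendsto (fun p : ℕ × ℕ => (‖A‖ ^ 2 - a ^ 2) * ‖x (φ p.1) - x (φ p.2)‖ ^ 2) atTop
          (𝓝 0) := by
        refine squeeze_zero (fun p => mul_nonneg hd.le (sq_nonneg _)) (fun p => key p.1 p.2) ?_
        convert h3 using 2
        ring
      have h6 := h5.const_mul (‖A‖ ^ 2 - a ^ 2)⁻¹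
      rw [mul_zero] at h6
      exact h6.congr fun p => inv_mul_cancel_left₀ hd.ne' _
    rw [cauchySeq_iff_tendsto_dist_atTop_0]
    simpa [dist_eq_norm, Real.sqrt_sq (norm_nonneg _)] using h4.sqrt
  obtain ⟨z, hz⟩ := cauchySeq_tendsto_of_complete hcau
  refine ⟨z, tendsto_nhds_unique hz.norm (by simp [hx1]), ?_⟩
  exact tendsto_nhds_unique ((A.continuous.tendsto z).comp hz).norm hAlim

/-- The Gelfand–Naimark–Segal construction for a positive semidefinite form: it is the pullback of
the inner product of a Hilbert space. -/
theorem exists_hilbertSpace_of_preInnerCore {P : Type} [AddCommGroup P] [Module ℂ P]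
    (c : PreInnerProductSpace.Core ℂ P) :
    ∃ (K : Type) (_ : NormedAddCommGroup K) (_ : InnerProductSpace ℂ K) (_ : CompleteSpace K)
      (ι : P →ₗ[ℂ] K), ∀ p q, ⟪ι p, ι q⟫_ℂ = c.inner p q := by
  let : SeminormedAddCommGroup P := InnerProductSpace.Core.toSeminormedAddCommGroup (𝕜 := ℂ)
  let : InnerProductSpace ℂ P := InnerProductSpace.ofCore c
  exact ⟨UniformSpace.Completion P, inferInstance, inferInstance, inferInstance,
    (UniformSpace.Completion.toComplL (𝕜 := ℂ) (E := P)).toLinearMap,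
    fun p q => UniformSpace.Completion.inner_coe p q⟩

variable {K : Type*} [NormedAddCommGroup K] [InnerProductSpace ℂ K] [CompleteSpace K]

/-- A partially defined isometry `a p ↦ b p` extends to a contraction: extend it to the closure of
its domain, and by zero to the orthogonal complement. -/
theorem exists_contraction_of_norm_eq {P : Type*} [AddCommGroup P] [Module ℂ P] (a b : P →ₗ[ℂ] K)
    (h : ∀ p, ‖b p‖ = ‖a p‖) : ∃ W : K →L[ℂ] K, ‖W‖ ≤ 1 ∧ ∀ p, W (a p) = b p := by
  set D := (LinearMap.range a).topologicalClosure
  have hD : ∀ p, a p ∈ D := fun p => Submodule.le_topologicalClosure _ ⟨p, rfl⟩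
  let a' : P →ₗ[ℂ] D := a.codRestrict D hD
  have hd : DenseRange a' := by
    intro x
    rw [Topology.IsInducing.subtypeVal.closure_eq_preimage_closure_image, ← Set.range_comp]
    exact x.2
  have hn : ∀ p, ‖b p‖ ≤ 1 * ‖a' p‖ := fun p => by rw [h, one_mul]; rfl
  have : CompleteSpace D := (Submodule.isClosed_topologicalClosure _).isComplete.completeSpace_coe
  refine ⟨(b.extendOfNorm a') ∘L D.orthogonalProjectionOnto, ?_, fun p => ?_⟩
  · refine (opNorm_comp_le _ _).trans (mul_le_one₀ ?_ (norm_nonneg _)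
      D.orthogonalProjectionOnto_norm_le)
    exact LinearMap.opNorm_extendOfNorm_le hd zero_le_one hn
  · have : D.orthogonalProjectionOnto (a p) = a' p :=
      D.orthogonalProjectionOnto_mem_subspace_eq_self (a' p)
    rw [comp_apply, this]
    exact LinearMap.extendOfNorm_eq hd ⟨1, hn⟩ p

/-- The adjoint of a contraction inverts it on the vectors whose norm it preserves. -/
theorem adjoint_apply_of_norm_eq {W : K →L[ℂ] K} (hW : ‖W‖ ≤ 1) {x : K} (hx : ‖W x‖ = ‖x‖) :
    adjoint W (W x) = x := by
  have h1 : ‖adjoint W (W x)‖ ≤ ‖x‖ := by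
    rw [← hx]
    refine ((adjoint W).le_of_opNorm_le (c := 1) ?_ _).trans (one_mul _).le
    rwa [LinearIsometryEquiv.norm_map]
  have h2 : RCLike.re ⟪adjoint W (W x), x⟫_ℂ = ‖x‖ ^ 2 := by
    rw [adjoint_inner_left, inner_self_eq_norm_sq, hx]
  have h3 := norm_sub_sq (𝕜 := ℂ) (adjoint W (W x)) x
  rw [h2] at h3
  have h4 : ‖adjoint W (W x) - x‖ ^ 2 ≤ 0 := by
    have := pow_le_pow_left₀ (norm_nonneg _) h1 2
    linarith
  exact sub_eq_zero.1 (norm_eq_zero.1 (pow_eq_zero_iff two_ne_zero |>.1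
    (le_antisymm h4 (sq_nonneg _))))

/-- The `k`-th power of `W` in the sense of dilation theory: `W ^ k` for `k ≥ 0`, and
`(W*) ^ (-k)` for `k < 0`. For a contraction `W`, this is the compression to `K` of the `k`-th
power of a unitary dilation. -/
noncomputable def dilPow (W : K →L[ℂ] K) (k : ℤ) : K →L[ℂ] K :=
  if 0 ≤ k then W ^ k.toNat else adjoint W ^ (-k).toNat

theorem dilPow_natCast (W : K →L[ℂ] K) (k : ℕ) : dilPow W k = W ^ k := by
  simp [dilPow]

theorem dilPow_neg_natCast (W : K →L[ℂ] K) (k : ℕ) : dilPow W (-k) = adjoint W ^ k := by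
  rcases k with _ | k
  · simp [dilPow]
  · rw [dilPow, if_neg (by omega)]
    congr 1

theorem dilPow_zero (W : K →L[ℂ] K) : dilPow W 0 = 1 := by simp [dilPow]

theorem inner_dilPow_neg (W : K →L[ℂ] K) (k : ℤ) (x y : K) :
    ⟪x, dilPow W (-k) y⟫_ℂ = ⟪dilPow W k x, y⟫_ℂ := by
  have h : ∀ k : ℕ, adjoint W ^ k = adjoint (W ^ k) := fun k => by
    simp only [← star_eq_adjoint, star_pow]
  obtain ⟨k, rfl | rfl⟩ := k.eq_nat_or_neg
  · rw [dilPow_neg_natCast, dilPow_natCast, h, adjoint_inner_right]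
  · rw [neg_neg, dilPow_neg_natCast, dilPow_natCast, h, adjoint_inner_left]

theorem dilPow_add (W : K →L[ℂ] K) {k l : ℤ} (hk : 0 ≤ k) (hl : 0 ≤ l) (x : K) :
    dilPow W (k + l) x = dilPow W k (dilPow W l x) := by
  lift k to ℕ using hk
  lift l to ℕ using hl
  rw [← Nat.cast_add, dilPow_natCast, dilPow_natCast, dilPow_natCast, pow_add, mul_apply_eq_comp]

theorem norm_dilPow_le {W : K →L[ℂ] K} (hW : ‖W‖ ≤ 1) {k : ℤ} (hk : 0 ≤ k) (x : K) :
    ‖dilPow W k x‖ ≤ ‖x‖ := by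
  lift k to ℕ using hk
  rw [dilPow_natCast]
  rcases k.eq_zero_or_pos with rfl | hk
  · simp
  · refine ((W ^ k).le_of_opNorm_le (c := 1) ?_ _).trans (one_mul _).le
    exact (norm_pow_le' W hk).trans (pow_le_one₀ (norm_nonneg _) hW)

/-- The Sz.-Nagy positivity of the operator-valued Toeplitz kernel of a contraction. -/
theorem re_sum_inner_dilPow_nonneg {W : K →L[ℂ] K} (hW : ‖W‖ ≤ 1) (h : ℤ → K) (S : Finset ℤ) :
    0 ≤ RCLike.re (∑ i ∈ S, ∑ j ∈ S, ⟪h j, dilPow W (i - j) (h i)⟫_ℂ) := by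
  -- an induction from the left end of `S` bounds the sum below by a square
  suffices H : ∀ a : ℤ, (∀ i ∈ S, a ≤ i) → ‖∑ i ∈ S, dilPow W (i - a) (h i)‖ ^ 2 ≤
      RCLike.re (∑ i ∈ S, ∑ j ∈ S, ⟪h j, dilPow W (i - j) (h i)⟫_ℂ) by
    obtain ⟨a, ha⟩ := S.bddBelow
    exact (sq_nonneg _).trans (H a fun i hi => ha hi)
  induction S using Finset.induction_on_min with
  | empty => simp
  | insert b S hb ih =>
    intro a ha
    have hbS : b ∉ S := fun hm => (hb b hm).false
    have hab : a ≤ b := ha b (Finset.mem_insert_self _ _)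
    set y := ∑ i ∈ S, dilPow W (i - b) (h i) with hy
    have h1 : ∑ i ∈ insert b S, dilPow W (i - a) (h i) = dilPow W (b - a) (h b + y) := by
      rw [Finset.sum_insert hbS, map_add, hy, map_sum]
      congr 1
      refine Finset.sum_congr rfl fun i hi => ?_
      rw [← dilPow_add W (by omega) (by have := hb i hi; omega)]
      congr 2
      ring
    have h2 : ∑ i ∈ insert b S, ∑ j ∈ insert b S, ⟪h j, dilPow W (i - j) (h i)⟫_ℂ =
        ⟪h b, h b⟫_ℂ + ⟪y, h b⟫_ℂ + (⟪h b, y⟫_ℂ +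
          ∑ i ∈ S, ∑ j ∈ S, ⟪h j, dilPow W (i - j) (h i)⟫_ℂ) := by
      simp only [Finset.sum_insert hbS, sub_self, dilPow_zero, Finset.sum_add_distrib, hy,
        sum_inner, inner_sum]
      congr 2
      refine Finset.sum_congr rfl fun i hi => ?_
      rw [← inner_dilPow_neg, neg_sub]
    have h3 : RCLike.re ⟪y, h b⟫_ℂ = RCLike.re ⟪h b, y⟫_ℂ := inner_re_symm _ _
    have h4 := ih b fun i hi => (hb i hi).le
    have h5 : ‖dilPow W (b - a) (h b + y)‖ ^ 2 ≤ ‖h b + y‖ ^ 2 :=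
      pow_le_pow_left₀ (norm_nonneg _) (norm_dilPow_le hW (by omega) _) 2
    have h6 := norm_add_sq (𝕜 := ℂ) (h b) y
    rw [h1, h2]
    refine h5.trans ?_
    rw [map_add, map_add, map_add, h3, inner_self_eq_norm_sq]
    linarith

end Operators

/-! ### Integrable functions on the circle and their Fourier coefficients -/

section Integrable

variable {E : Type*} [NormedAddCommGroup E] [NormedSpace ℂ E]

theorem integrable_continuousMap_smul (φ : C(AddCircle (1 : ℝ), ℂ)) {g : AddCircle (1 : ℝ) → E}
    (hg : Integrable g 𝔪) : Integrable (fun t => φ t • g t) 𝔪 :=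
  hg.bdd_smul ‖φ‖ φ.continuous.aestronglyMeasurable
    (Eventually.of_forall fun t => φ.norm_coe_le_norm t)

/-- Integration of continuous functions against an integrable density `g`. -/
noncomputable def integralAgainst (g : AddCircle (1 : ℝ) → E) (hg : Integrable g 𝔪) :
    C(AddCircle (1 : ℝ), ℂ) →L[ℂ] E :=
  LinearMap.mkContinuous
    { toFun := fun φ => ∫ t, φ t • g t ∂𝔪
      map_add' := fun φ ψ => by
        simp only [ContinuousMap.add_apply, add_smul]
        exact integral_add (integrable_continuousMap_smul φ hg) (integrable_continuousMap_smul ψ hg)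
      map_smul' := fun c φ => by
        simp only [ContinuousMap.smul_apply, smul_assoc, RingHom.id_apply]
        exact integral_smul c _ }
    (∫ t, ‖g t‖ ∂𝔪) fun φ => by
      refine (norm_integral_le_integral_norm _).trans ?_
      rw [← integral_mul_const]
      refine integral_mono (integrable_continuousMap_smul φ hg).norm (hg.norm.mul_const _)
        fun t => ?_
      simp only [norm_smul, mul_comm ‖g t‖]
      exact mul_le_mul_of_nonneg_right (φ.norm_coe_le_norm t) (norm_nonneg _)

theorem integralAgainst_apply (g : AddCircle (1 : ℝ) → E) (hg : Integrable g 𝔪)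
    (φ : C(AddCircle (1 : ℝ), ℂ)) : integralAgainst g hg φ = ∫ t, φ t • g t ∂𝔪 := rfl

theorem dense_span_fourier :
    Dense (Submodule.span ℂ (Set.range (fourier (T := (1 : ℝ)))) : Set C(AddCircle (1 : ℝ), ℂ)) :=
  Submodule.dense_iff_topologicalClosure_eq_top.2 span_fourier_closure_eq_top

theorem tendsto_integral_thickenedIndicator {F : Type*} [NormedAddCommGroup F]
    [NormedSpace ℝ F] {g : AddCircle (1 : ℝ) → F}
    (hg : Integrable g 𝔪) {s : Set (AddCircle (1 : ℝ))} (hs : IsClosed s) {δ : ℕ → ℝ}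
    (hδ : ∀ k, 0 < δ k) (hδ0 : Tendsto δ atTop (𝓝 0)) :
    Tendsto (fun k => ∫ t, (thickenedIndicator (hδ k) s t : ℝ) • g t ∂𝔪) atTop
      (𝓝 (∫ t in s, g t ∂𝔪)) := by
  rw [← integral_indicator hs.measurableSet]
  refine tendsto_integral_of_dominated_convergence (fun t => ‖g t‖) (fun k => ?_) hg.norm
    (fun k => Eventually.of_forall fun t => ?_) (Eventually.of_forall fun t => ?_)
  · exact (NNReal.continuous_coe.comp
      (thickenedIndicator (hδ k) s).continuous).aestronglyMeasurable.smul hg.aestronglyMeasurable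
  · rw [norm_smul, NNReal.norm_eq]
    exact mul_le_of_le_one_left (norm_nonneg _) (thickenedIndicator_le_one (hδ k) s t)
  · have h1 := tendsto_pi_nhds.1 (thickenedIndicator_tendsto_indicator_closure hδ hδ0 s) t
    rw [hs.closure_eq] at h1
    have h2 := ((NNReal.continuous_coe.tendsto _).comp h1).smul_const (g t)
    convert h2 using 2
    · rfl
    by_cases ht : t ∈ s
    · rw [Set.indicator_of_mem ht, Set.indicator_of_mem ht, NNReal.coe_one, one_smul]
    · rw [Set.indicator_of_notMem ht, Set.indicator_of_notMem ht, NNReal.coe_zero, zero_smul]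

/-- Uniqueness of Fourier coefficients. -/
theorem ae_eq_zero_of_fourierCoeff_eq_zero [CompleteSpace E] {g : AddCircle (1 : ℝ) → E}
    (hg : Integrable g 𝔪) (h : ∀ k, fourierCoeff g k = 0) : g =ᵐ[𝔪] 0 := by
  have h0 : integralAgainst g hg = 0 := by
    refine ContinuousLinearMap.ext_on dense_span_fourier ?_
    rintro _ ⟨k, rfl⟩
    have := h (-k)
    rwa [fourierCoeff, neg_neg] at this
  refine ae_eq_zero_of_forall_setIntegral_isClosed_eq_zero hg fun s hs => ?_
  have hδ : ∀ k : ℕ, (0 : ℝ) < 1 / (k + 1) := fun k => Nat.one_div_pos_of_nat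
  refine tendsto_nhds_unique (tendsto_integral_thickenedIndicator hg hs hδ
    tendsto_one_div_add_atTop_nhds_zero_nat) ?_
  refine tendsto_const_nhds.congr fun k => ?_
  have := DFunLike.congr_fun h0 ⟨fun t => ((thickenedIndicator (hδ k) s t : ℝ) : ℂ), by fun_prop⟩
  rw [integralAgainst_apply, zero_apply] at this
  rw [← this]
  exact integral_congr_ae (Eventually.of_forall fun t => RCLike.real_smul_eq_coe_smul (K := ℂ) _ _)

/-- A function whose Fourier coefficients form a positive semidefinite Toeplitz kernel is
nonnegative: the kernel says that its integral against `|φ|²` is nonnegative for every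
trigonometric polynomial `φ`. -/
theorem ae_nonneg_re_of_toeplitz_nonneg {g : AddCircle (1 : ℝ) → ℂ} (hg : Integrable g 𝔪)
    (h : ∀ (S : Finset ℤ) (c : ℤ → ℂ),
      0 ≤ (∑ i ∈ S, ∑ j ∈ S, conj (c j) * c i * fourierCoeff g (j - i)).re) :
    ∀ᵐ t ∂𝔪, 0 ≤ (g t).re := by
  have h1 : ∀ φ : C(AddCircle (1 : ℝ), ℂ), 0 ≤ (integralAgainst g hg (star φ * φ)).re := fun φ => by
    refine dense_span_fourier.induction (P := fun φ => 0 ≤ (integralAgainst g hg (star φ * φ)).re)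
      (fun φ hφ => ?_) (isClosed_le continuous_const (by fun_prop)) φ
    obtain ⟨c, rfl⟩ := Finsupp.mem_span_range_iff_exists_finsupp.1 hφ
    convert h c.support c using 2
    simp only [Finsupp.sum, star_sum, Finset.sum_mul_sum, map_sum, star_smul, smul_mul_smul_comm,
      map_smul, smul_eq_mul]
    rw [Finset.sum_comm]
    refine Finset.sum_congr rfl fun i _ => Finset.sum_congr rfl fun j _ => ?_
    congr 1
    rw [integralAgainst_apply, fourierCoeff]
    refine integral_congr_ae (Eventually.of_forall fun t => ?_)
    simp only [ContinuousMap.mul_apply, ContinuousMap.star_apply]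
    rw [neg_sub, sub_eq_neg_add, fourier_add, fourier_neg]
    rfl
  have hre : Integrable (fun t => (g t).re) 𝔪 := hg.re
  have h2 : ∀ s, IsClosed s → 0 ≤ ∫ t in s, (g t).re ∂𝔪 := fun s hs => by
    have hδ : ∀ k : ℕ, (0 : ℝ) < 1 / (k + 1) := fun k => Nat.one_div_pos_of_nat
    refine ge_of_tendsto' (tendsto_integral_thickenedIndicator hre hs hδ
      tendsto_one_div_add_atTop_nhds_zero_nat) fun k => ?_
    set φ : C(AddCircle (1 : ℝ), ℂ) :=
      ⟨fun t => ((√(thickenedIndicator (hδ k) s t : ℝ) : ℝ) : ℂ), by fun_prop⟩ with hφ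
    have h3 := h1 φ
    rw [integralAgainst_apply] at h3
    rw [← RCLike.re_eq_complex_re] at h3
    rw [← integral_re (integrable_continuousMap_smul _ hg)] at h3
    refine h3.trans_eq (integral_congr_ae (Eventually.of_forall fun t => ?_))
    have : (star φ * φ) t = ((thickenedIndicator (hδ k) s t : ℝ) : ℂ) := by
      simp only [hφ, ContinuousMap.mul_apply, ContinuousMap.star_apply, ContinuousMap.coe_mk,
        Complex.star_def, Complex.conj_ofReal, ← Complex.ofReal_mul]
      rw [Real.mul_self_sqrt NNReal.zero_le_coe]
    simp only [this, smul_eq_mul, RCLike.re_eq_complex_re, Complex.re_ofReal_mul]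
  -- a set of positive measure where `g.re < 0` would contain a compact one
  by_contra hcon
  have hm : NullMeasurableSet {t | (g t).re < 0} 𝔪 :=
    nullMeasurableSet_lt hre.aemeasurable aemeasurable_const
  have hpos : 0 < 𝔪 {t | (g t).re < 0} := by
    rw [pos_iff_ne_zero]
    intro h0
    exact hcon ((measure_eq_zero_iff_ae_notMem.1 h0).mono fun t ht => not_lt.1 ht)
  obtain ⟨B, hBA, hB, hBae⟩ := hm.exists_measurable_subset_ae_eq
  rw [← measure_congr hBae] at hpos
  obtain ⟨C, hCB, hC, hC0⟩ := hB.exists_lt_isCompact hpos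
  have h4 := h2 C hC.isClosed
  have h5 : 0 < ∫ t in C, -(g t).re ∂𝔪 := by
    rw [setIntegral_pos_iff_support_of_nonneg_ae]
    · refine hC0.trans_le (measure_mono fun t ht => ⟨?_, ht⟩)
      have : (g t).re < 0 := hBA (hCB ht)
      simp [this.ne]
    · exact (ae_restrict_iff' hC.measurableSet).2 (Eventually.of_forall fun t ht =>
        neg_nonneg.2 (show (g t).re < 0 from hBA (hCB ht)).le)
    · exact hre.neg.integrableOn
  rw [integral_neg] at h5
  linarith

end Integrable

/-! ### Powers of the shift on `L²` and Hardy spaces -/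

section Shift

variable {E : Type} [NormedAddCommGroup E] [NormedSpace ℂ E]

theorem norm_fourier_apply (k : ℤ) (t : AddCircle (1 : ℝ)) : ‖fourier k t‖ = 1 := by
  rw [fourier_apply, Circle.norm_coe]

theorem memLp_fourier_smul (k : ℤ) (f : LpCircle E 2) :
    MemLp (fun t => fourier k t • f t) 2 𝔪 :=
  (Lp.memLp f).of_le (((fourier k).continuous.aestronglyMeasurable).smul
    (Lp.aestronglyMeasurable f))
    (Eventually.of_forall fun t => by rw [norm_smul, norm_fourier_apply, one_mul])

/-- The `k`-th power of the bilateral shift, `f ↦ ζ ^ k f`, on `L²(E)`. -/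
noncomputable def shift (k : ℤ) : LpCircle E 2 →ₗᵢ[ℂ] LpCircle E 2 where
  toFun f := (memLp_fourier_smul k f).toLp
  map_add' f g := by
    rw [← MemLp.toLp_add]
    refine MemLp.toLp_congr _ _ ?_
    filter_upwards [Lp.coeFn_add f g] with t ht
    rw [ht, Pi.add_apply, Pi.add_apply, smul_add]
  map_smul' c f := by
    rw [RingHom.id_apply, ← MemLp.toLp_const_smul]
    refine MemLp.toLp_congr _ _ ?_
    filter_upwards [Lp.coeFn_smul c f] with t ht
    rw [ht, Pi.smul_apply, Pi.smul_apply, smul_comm]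
  norm_map' f := by
    refine le_antisymm (Lp.norm_le_norm_of_ae_le ?_) (Lp.norm_le_norm_of_ae_le ?_) <;>
    · filter_upwards [MemLp.coeFn_toLp (memLp_fourier_smul k f)] with t ht
      simp only [LinearMap.coe_mk, AddHom.coe_mk]
      rw [ht, norm_smul, norm_fourier_apply, one_mul]

theorem coeFn_shift (k : ℤ) (f : LpCircle E 2) :
    ∀ᵐ t ∂𝔪, shift k f t = fourier k t • f t :=
  MemLp.coeFn_toLp (memLp_fourier_smul k f)

theorem shift_shift (k l : ℤ) (f : LpCircle E 2) : shift k (shift l f) = shift (k + l) f := by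
  refine Lp.ext ?_
  filter_upwards [coeFn_shift k (shift l f), coeFn_shift l f, coeFn_shift (k + l) f]
    with t h1 h2 h3
  rw [h1, h2, h3, fourier_add, mul_smul]

theorem shift_zero (f : LpCircle E 2) : shift 0 f = f := by
  refine Lp.ext ?_
  filter_upwards [coeFn_shift 0 f] with t h
  rw [h, fourier_zero, one_smul]

theorem fourierCoeff_shift (k l : ℤ) (f : LpCircle E 2) :
    fourierCoeff (shift k f) l = fourierCoeff f (l - k) := by
  rw [fourierCoeff_congr_ae (coeFn_shift k f)]
  simp only [fourierCoeff, ← mul_smul, ← fourier_add]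
  rw [show -(l - k) = -l + k by ring]

theorem shift_mem_hardy {k : ℤ} (hk : 0 ≤ k) {f : LpCircle E 2} (hf : f ∈ hardy E 2) :
    shift k f ∈ hardy E 2 := fun l hl => by
  rw [fourierCoeff_shift]
  exact hf _ (by omega)

/-- The vector-valued monomial `ζ ^ k x`. -/
noncomputable def mono (k : ℤ) (x : E) : LpCircle E 2 := shift k (Lp.const 2 𝔪 x)

theorem coeFn_mono (k : ℤ) (x : E) : ∀ᵐ t ∂𝔪, mono k x t = fourier k t • x := by
  filter_upwards [coeFn_shift k (Lp.const 2 𝔪 x), Lp.coeFn_const 2 𝔪 x] with t h1 h2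
  rw [mono, h1, h2, Function.const_apply]

theorem shift_mono (k l : ℤ) (x : E) : shift k (mono l x) = mono (k + l) x :=
  shift_shift k l _

theorem mono_add (k : ℤ) (x y : E) : mono k (x + y) = mono k x + mono k y := by
  rw [mono, map_add, map_add]; rfl

theorem mono_smul (k : ℤ) (c : ℂ) (x : E) : mono k (c • x) = c • mono k x := by
  rw [mono, mono, ← map_smul]
  rfl

theorem fourierCoeff_const [CompleteSpace E] (x : E) (k : ℤ) :
    fourierCoeff (fun _ : AddCircle (1 : ℝ) => x) k = if k = 0 then x else 0 := by
  have h := congr_fun (fourierCoeff_fourier (T := 1) 0) k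
  simp only [fourierCoeff, fourier_zero, smul_eq_mul, mul_one] at h
  rw [fourierCoeff, integral_smul_const, h, Pi.single_apply, ite_smul, one_smul, zero_smul]

theorem fourierCoeff_mono [CompleteSpace E] (k l : ℤ) (x : E) :
    fourierCoeff (mono k x) l = if l = k then x else 0 := by
  rw [mono, fourierCoeff_shift, fourierCoeff_congr_ae (Lp.coeFn_const 2 𝔪 x)]
  exact (fourierCoeff_const x _).trans (by simp only [sub_eq_zero])

theorem mono_mem_hardy [CompleteSpace E] {k : ℤ} (hk : 0 ≤ k) (x : E) : mono k x ∈ hardy E 2 :=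
  fun l hl => by
  rw [fourierCoeff_mono, if_neg (by omega)]

end Shift

section Inner

variable {E : Type} [NormedAddCommGroup E] [InnerProductSpace ℂ E]

theorem inner_shift_left (k : ℤ) (f g : LpCircle E 2) :
    ⟪shift k f, g⟫_ℂ = ⟪f, shift (-k) g⟫_ℂ := by
  rw [← (shift (-k)).inner_map_map (shift k f), shift_shift, neg_add_cancel, shift_zero]

theorem shift_neg_one_mem_orthogonal {g : LpCircle E 2} (hg : g ∈ (hardy E 2)ᗮ) :
    shift (-1) g ∈ (hardy E 2)ᗮ := fun f hf => by
  rw [← inner_shift_left]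
  exact hg _ (shift_mem_hardy zero_le_one hf)

variable [CompleteSpace E]

theorem inner_mono_left (k : ℤ) (x : E) (f : LpCircle E 2) :
    ⟪mono k x, f⟫_ℂ = ⟪x, fourierCoeff f k⟫_ℂ := by
  rw [L2.inner_def, fourierCoeff, ← integral_inner]
  · refine integral_congr_ae ?_
    filter_upwards [coeFn_mono k x] with t ht
    rw [ht, inner_smul_left, inner_smul_right, fourier_neg]
  · exact (integrable_lpCircle f).fourier_smul _

theorem inner_mono_mono (k l : ℤ) (x y : E) :
    ⟪mono k x, mono l y⟫_ℂ = if k = l then ⟪x, y⟫_ℂ else 0 := by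
  rw [inner_mono_left, fourierCoeff_mono]
  split_ifs <;> simp

theorem mono_mem_orthogonal {k : ℤ} (hk : k < 0) (x : E) : mono k x ∈ (hardy E 2)ᗮ :=
  fun f hf => by rw [← inner_conj_symm, inner_mono_left, hf k hk, inner_zero_right, map_zero]

/-- Analytic polynomials are dense in `H²`, by uniqueness of Fourier coefficients. -/
theorem hardy_le_closure_span_mono :
    hardy E 2 ≤ (Submodule.span ℂ
      {f | ∃ (k : ℤ) (x : E), 0 ≤ k ∧ f = mono k x}).topologicalClosure := by
  set M := (Submodule.span ℂ
    {f : LpCircle E 2 | ∃ (k : ℤ) (x : E), 0 ≤ k ∧ f = mono k x}).topologicalClosure with hM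
  have hmem : ∀ k (x : E), 0 ≤ k → mono k x ∈ M := fun k x hk =>
    Submodule.le_topologicalClosure _ (Submodule.subset_span ⟨k, x, hk, rfl⟩)
  have hMH : M ≤ hardy E 2 := by
    refine Submodule.topologicalClosure_minimal _ (Submodule.span_le.2 ?_) isClosed_hardy
    rintro _ ⟨k, x, hk, rfl⟩
    exact mono_mem_hardy hk x
  have : CompleteSpace M := (Submodule.isClosed_topologicalClosure _).isComplete.completeSpace_coe
  intro f hf
  obtain ⟨g, hg, h, hh, rfl⟩ := M.exists_add_mem_mem_orthogonal f
  have hh' : h ∈ hardy E 2 := by simpa using sub_mem hf (hMH hg)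
  have h0 : ∀ k, fourierCoeff h k = 0 := fun k => by
    rcases lt_or_ge k 0 with hk | hk
    · exact hh' k hk
    · refine ext_inner_left ℂ fun x => ?_
      rw [← inner_mono_left, inner_zero_right]
      exact hh _ (hmem k x hk)
  have : h = 0 := (Lp.eq_zero_iff_ae_eq_zero).2
    (ae_eq_zero_of_fourierCoeff_eq_zero (integrable_lpCircle h) h0)
  rwa [this, add_zero]

/-- A uniqueness theorem for boundary values: a nonzero function in `H²` is nonzero almost
everywhere. The proof is Helson's: after division by a power of `ζ` the mean of `f` is not zero, so
the component `g` of `f` orthogonal to the span of `ζ f, ζ² f, …` is not zero. It is orthogonal to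
`ζ ^ k g` for all `k > 0`, so that `‖g‖²` is constant, while `g` vanishes wherever `f` does. -/
theorem ae_ne_zero_of_mem_hardy {f : LpCircle E 2} (hf : f ∈ hardy E 2) (hf0 : f ≠ 0) :
    ∀ᵐ t ∂𝔪, f t ≠ 0 := by
  wlog hmean : fourierCoeff f 0 ≠ 0 generalizing f
  · have hex : ∃ k : ℕ, fourierCoeff f k ≠ 0 := by
      by_contra! hcon
      refine hf0 ((Lp.eq_zero_iff_ae_eq_zero).2
        (ae_eq_zero_of_fourierCoeff_eq_zero (integrable_lpCircle f) fun k => ?_))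
      rcases lt_or_ge k 0 with hk | hk
      · exact hf k hk
      · lift k to ℕ using hk
        exact hcon k
    classical
    have hk := Nat.find_spec hex
    have hlt := fun l => Nat.find_min hex (m := l)
    set k := Nat.find hex
    have h1 : shift (-k : ℤ) f ∈ hardy E 2 := fun l hl => by
      rw [fourierCoeff_shift]
      rcases lt_or_ge (l - -k) 0 with h | h
      · exact hf _ h
      · obtain ⟨j, hj⟩ := Int.eq_ofNat_of_zero_le h
        rw [hj]
        exact not_not.1 (hlt j (by omega))
    have h2 : shift (-k : ℤ) f ≠ 0 := by
      rwa [Ne, ← norm_eq_zero, LinearIsometry.norm_map, norm_eq_zero]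
    filter_upwards [this h1 h2 (by rwa [fourierCoeff_shift, zero_sub, neg_neg]),
      coeFn_shift (-k : ℤ) f] with t ht h3 h4
    exact ht (by rw [h3, h4, smul_zero])
  set M := (Submodule.span ℂ
    {g : LpCircle E 2 | ∃ k : ℤ, 0 < k ∧ g = shift k f}).topologicalClosure with hM
  have : CompleteSpace M := (Submodule.isClosed_topologicalClosure _).isComplete.completeSpace_coe
  have hmem : ∀ k : ℤ, 0 < k → shift k f ∈ M := fun k hk =>
    Submodule.le_topologicalClosure _ (Submodule.subset_span ⟨k, hk, rfl⟩)
  obtain ⟨p, hp, g, hg, hfpg⟩ := M.exists_add_mem_mem_orthogonal f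
  obtain rfl : g = f - p := eq_sub_of_add_eq' hfpg.symm
  set g := f - p
  have hMle : ∀ N : Submodule ℂ (LpCircle E 2), IsClosed (N : Set (LpCircle E 2)) →
      (∀ k : ℤ, 0 < k → shift k f ∈ N) → M ≤ N := fun N hN h => by
    refine Submodule.topologicalClosure_minimal _ (Submodule.span_le.2 ?_) hN
    rintro _ ⟨k, hk, rfl⟩
    exact h k hk
  -- functions in `M` have mean zero, unlike `f`
  have hg0 : g ≠ 0 := fun h0 => by
    rw [← sub_eq_zero.1 h0] at hp
    refine hmean (ext_inner_left ℂ fun x => ?_)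
    rw [← inner_mono_left, inner_zero_right]
    refine (Submodule.mem_orthogonal_singleton_iff_inner_right).1 (hMle (ℂ ∙ mono 0 x)ᗮ
      (Submodule.isClosed_orthogonal _) (fun k hk => ?_) hp)
    rw [Submodule.mem_orthogonal_singleton_iff_inner_right, inner_mono_left, fourierCoeff_shift,
      hf _ (by omega), inner_zero_right]
  have hshift : ∀ k : ℤ, 0 < k → shift k g ∈ M := fun k hk => by
    rw [map_sub]
    refine sub_mem (hmem k hk) (hMle (M.comap (shift k).toLinearMap)
      ((Submodule.isClosed_topologicalClosure _).preimage (shift k).continuous) (fun l hl => ?_) hp)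
    rw [Submodule.mem_comap, LinearIsometry.coe_toLinearMap, shift_shift]
    exact hmem _ (by omega)
  have horth : ∀ k : ℤ, k ≠ 0 → ⟪g, shift k g⟫_ℂ = 0 := fun k hk => by
    rcases hk.lt_or_gt with hk | hk
    · rw [← neg_neg k, ← inner_shift_left]
      exact hg _ (hshift _ (by omega))
    · rw [← inner_conj_symm, hg _ (hshift k hk), map_zero]
  have hGint : Integrable (fun t => ⟪g t, g t⟫_ℂ) 𝔪 := L2.integrable_inner g g
  have hG : ∀ k, fourierCoeff (fun t => ⟪g t, g t⟫_ℂ) k = ⟪g, shift (-k) g⟫_ℂ := fun k => by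
    rw [L2.inner_def, fourierCoeff]
    refine integral_congr_ae ?_
    filter_upwards [coeFn_shift (-k) g] with t ht
    rw [ht, inner_smul_right, smul_eq_mul]
  have hconst : (fun t => ⟪g t, g t⟫_ℂ - ⟪g, g⟫_ℂ) =ᵐ[𝔪] 0 := by
    refine ae_eq_zero_of_fourierCoeff_eq_zero (hGint.sub (integrable_const _)) fun k => ?_
    have h1 : fourierCoeff (fun t => ⟪g t, g t⟫_ℂ - ⟪g, g⟫_ℂ) k =
        fourierCoeff (fun t => ⟪g t, g t⟫_ℂ) k -
          fourierCoeff (fun _ => ⟪g, g⟫_ℂ : AddCircle (1 : ℝ) → ℂ) k := by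
      simp only [fourierCoeff, smul_sub]
      exact integral_sub (hGint.fourier_smul _) ((integrable_const _).fourier_smul _)
    rw [h1, hG, fourierCoeff_const]
    split_ifs with hk
    · rw [hk, neg_zero, shift_zero, sub_self]
    · rw [horth _ (neg_ne_zero.2 hk), sub_zero]
  -- `g` is orthogonal to its own restriction to the zero set of `f`
  set s := {t | f t = 0} with hs
  have hsm : MeasurableSet s :=
    (Lp.stronglyMeasurable f).measurableSet_eq_fun stronglyMeasurable_const
  set w : LpCircle E 2 := ((Lp.memLp g).indicator hsm).toLp with hw
  have hwt : ∀ᵐ t ∂𝔪, w t = s.indicator g t := MemLp.coeFn_toLp _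
  have hwf : ∀ k, ⟪w, shift k f⟫_ℂ = 0 := fun k => by
    rw [L2.inner_def]
    refine integral_eq_zero_of_ae ?_
    filter_upwards [hwt, coeFn_shift k f] with t h1 h2
    rw [h1, h2]
    by_cases ht : t ∈ s
    · rw [show f t = 0 from ht]
      simp
    · rw [Set.indicator_of_notMem ht]
      simp
  have hwg : ⟪w, g⟫_ℂ = 0 := by
    have h1 : p ∈ (ℂ ∙ w)ᗮ := hMle _ (Submodule.isClosed_orthogonal _)
      (fun k _ => Submodule.mem_orthogonal_singleton_iff_inner_right.2 (hwf k)) hp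
    rw [inner_sub_right, Submodule.mem_orthogonal_singleton_iff_inner_right.1 h1, ← shift_zero f,
      hwf, sub_zero]
  have hint : ⟪w, g⟫_ℂ = ∫ t in s, ⟪g, g⟫_ℂ ∂𝔪 := by
    rw [L2.inner_def, ← integral_indicator hsm]
    refine integral_congr_ae ?_
    filter_upwards [hwt, hconst] with t h1 h2
    rw [h1]
    by_cases ht : t ∈ s
    · rw [Set.indicator_of_mem ht, Set.indicator_of_mem ht]
      exact sub_eq_zero.1 h2
    · rw [Set.indicator_of_notMem ht, Set.indicator_of_notMem ht, inner_zero_left]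
  rw [hwg, setIntegral_const, eq_comm, smul_eq_zero] at hint
  have hμ : 𝔪 s = 0 := by
    rcases hint with h | h
    · exact (measureReal_eq_zero_iff).1 h
    · exact absurd (inner_self_eq_zero.1 h) hg0
  exact measure_eq_zero_iff_ae_notMem.1 hμ

end Inner

/-! ### Multiplication by bounded matrix functions -/

section Multiplication

variable {m n : ℕ}

theorem ae_norm_le_norm (Φ : LpCircle (Mat m n) ∞) : ∀ᵐ t ∂𝔪, ‖Φ t‖ ≤ ‖Φ‖ := by
  have h := ae_le_eLpNormEssSup (f := Φ) (μ := 𝔪)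
  filter_upwards [h] with t ht
  rw [← eLpNorm_exponent_top] at ht
  have := ENNReal.toReal_mono (Lp.eLpNorm_ne_top Φ) ht
  rwa [toReal_enorm] at this

theorem norm_mulOp_apply_le (Φ : LpCircle (Mat m n) ∞) (f : LpCircle (Vec n) 2) :
    ‖mulOp Φ f‖ ≤ ‖Φ‖ * ‖f‖ := by
  refine Lp.norm_le_mul_norm_of_ae_le_mul ?_
  filter_upwards [coeFn_mulOp Φ f, ae_norm_le_norm Φ] with t h1 h2
  rw [h1]
  exact ((matAct m n (Φ t)).le_opNorm _).trans
    (mul_le_mul_of_nonneg_right ((norm_matAct _).trans_le h2) (norm_nonneg _))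

theorem mulOp_sub_apply (Φ F : LpCircle (Mat m n) ∞) (f : LpCircle (Vec n) 2) :
    mulOp (Φ - F) f = mulOp Φ f - mulOp F f := by
  rw [mulOp, map_sub]; rfl

theorem mulOp_shift (Φ : LpCircle (Mat m n) ∞) (k : ℤ) (f : LpCircle (Vec n) 2) :
    mulOp Φ (shift k f) = shift k (mulOp Φ f) := by
  refine Lp.ext ?_
  filter_upwards [coeFn_mulOp Φ (shift k f), coeFn_shift k f, coeFn_shift k (mulOp Φ f),
    coeFn_mulOp Φ f] with t h1 h2 h3 h4
  rw [h1, h2, h3, h4, map_smul]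

/-- The action of matrices on a fixed vector. -/
noncomputable def matActFlip (m : ℕ) {n : ℕ} (x : Vec n) : Mat m n →L[ℂ] Vec m :=
  (matAct m n).flip x

theorem fourierCoeff_matAct {Ψ : AddCircle (1 : ℝ) → Mat m n} (hΨ : Integrable Ψ 𝔪) (x : Vec n)
    (k : ℤ) : fourierCoeff (fun t => matAct m n (Ψ t) x) k = matAct m n (fourierCoeff Ψ k) x := by
  have h := (matActFlip m x).integral_comp_comm (hΨ.fourier_smul (-k))
  rw [fourierCoeff, fourierCoeff]
  refine Eq.trans ?_ h
  refine integral_congr_ae (Eventually.of_forall fun t => ?_)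
  exact ((matActFlip m x).map_smul _ _).symm

theorem fourierCoeff_mulOp_mono (Φ : LpCircle (Mat m n) ∞) (j k : ℤ) (x : Vec n) :
    fourierCoeff (mulOp Φ (mono j x)) k = matAct m n (fourierCoeff Φ (k - j)) x := by
  have : mono j x = shift j (mono 0 x) := by rw [shift_mono, add_zero]
  rw [this, mulOp_shift, fourierCoeff_shift, ← fourierCoeff_matAct (integrable_lpCircle Φ)]
  refine congr_fun (fourierCoeff_congr_ae ?_) _
  filter_upwards [coeFn_mulOp Φ (mono 0 x), coeFn_mono 0 x] with t h1 h2
  rw [h1, h2, fourier_zero, one_smul]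

/-- `H^∞` multiplies `H²` into itself. -/
theorem mulOp_mem_hardy {F : LpCircle (Mat m n) ∞} (hF : F ∈ hardy (Mat m n) ∞)
    {f : LpCircle (Vec n) 2} (hf : f ∈ hardy (Vec n) 2) : mulOp F f ∈ hardy (Vec m) 2 := by
  have h : (Submodule.span ℂ
      {f | ∃ (k : ℤ) (x : Vec n), 0 ≤ k ∧ f = mono k x}).topologicalClosure ≤
      (hardy (Vec m) 2).comap (mulOp F).toLinearMap := by
    refine Submodule.topologicalClosure_minimal _ (Submodule.span_le.2 ?_)
      (isClosed_hardy.preimage (mulOp F).continuous)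
    rintro _ ⟨k, x, hk, rfl⟩ l hl
    rw [ContinuousLinearMap.coe_coe, fourierCoeff_mulOp_mono, hF _ (by omega), map_zero, zero_apply]
  exact h (hardy_le_closure_span_mono hf)

/-- The bilinear form of the Hankel operator only sees `Φ` modulo `H^∞`. -/
theorem inner_mulOp_eq_inner_mulOp_sub (Φ : LpCircle (Mat m n) ∞) {F : LpCircle (Mat m n) ∞}
    (hF : F ∈ hardy (Mat m n) ∞) {f : LpCircle (Vec n) 2} (hf : f ∈ hardy (Vec n) 2)
    {g : LpCircle (Vec m) 2} (hg : g ∈ (hardy (Vec m) 2)ᗮ) :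
    ⟪g, mulOp Φ f⟫_ℂ = ⟪g, mulOp (Φ - F) f⟫_ℂ := by
  rw [mulOp_sub_apply, inner_sub_right, ← inner_conj_symm g (mulOp F f),
    hg _ (mulOp_mem_hardy hF hf), map_zero, sub_zero]

theorem toeplitz_eq_zero_iff {Φ : LpCircle (Mat m n) ∞} {f : hardy (Vec n) 2} :
    toeplitz Φ f = 0 ↔ mulOp Φ (f : LpCircle (Vec n) 2) ∈ (hardy (Vec m) 2)ᗮ := by
  rw [toeplitz, comp_apply, comp_apply, Submodule.orthogonalProjectionOnto_eq_zero_iff,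
    Submodule.subtypeL_apply]

theorem hankel_apply (Φ : LpCircle (Mat m n) ∞) (f : hardy (Vec n) 2) :
    hankel Φ f =
      (hardy (Vec m) 2)ᗮ.orthogonalProjectionOnto (mulOp Φ (f : LpCircle (Vec n) 2)) := rfl

theorem inner_hankel (Φ : LpCircle (Mat m n) ∞) (f : hardy (Vec n) 2)
    (g : ↥(hardy (Vec m) 2)ᗮ) :
    ⟪g, hankel Φ f⟫_ℂ = ⟪(g : LpCircle (Vec m) 2), mulOp Φ (f : LpCircle (Vec n) 2)⟫_ℂ := by
  rw [hankel_apply]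
  exact Submodule.inner_orthogonalProjectionOnto_eq_of_mem_left g _

end Multiplication

/-! ### A sufficient condition for bad approximability -/

section Sufficiency

variable {m n : ℕ}

/-- Constant norm and a maximizing function in the kernel of `T_Φ` make the Hankel operator as
large as `Φ`, so that no `F` in `H^∞` can bring `Φ` closer to zero. -/
theorem badlyApproximable_of_hasMaximizingKernelFunction {Φ : LpCircle (Mat m n) ∞}
    (hc : HasConstantNorm Φ) (hm : HasMaximizingKernelFunction Φ) : BadlyApproximable Φ := by
  obtain ⟨c, hc⟩ := hc
  obtain ⟨f, hf, hmax⟩ := hm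
  rw [toeplitz_eq_zero_iff] at hf
  have hc0 : 0 ≤ c := by
    obtain ⟨t, ht⟩ := hc.exists
    exact ht ▸ norm_nonneg _
  have hΦc : ‖Φ‖ ≤ c := Lp.norm_le_of_ae_bound hc0 (hc.mono fun t ht => ht.le) |>.trans
    (by simp)
  have hf0 : 0 < ‖(f : LpCircle (Vec n) 2)‖ := norm_pos_iff.2 fun h0 => by
    have h1 := (Lp.eq_zero_iff_ae_eq_zero).1 h0
    obtain ⟨t, h2, h3⟩ := (h1.and hmax).exists
    exact h3.1 h2
  have hlow : c * ‖(f : LpCircle (Vec n) 2)‖ ≤ ‖mulOp Φ (f : LpCircle (Vec n) 2)‖ := by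
    rw [← Complex.norm_of_nonneg hc0, ← norm_smul]
    refine Lp.norm_le_norm_of_ae_le ?_
    filter_upwards [coeFn_mulOp Φ (f : LpCircle (Vec n) 2), hc, hmax,
      Lp.coeFn_smul (c : ℂ) (f : LpCircle (Vec n) 2)] with t h1 h2 h3 h4
    rw [h1, h3.2, h2, h4, Pi.smul_apply, norm_smul, Complex.norm_of_nonneg hc0]
  refine le_antisymm (le_ciInf fun F => ?_) ?_
  · set g := mulOp Φ (f : LpCircle (Vec n) 2)
    have h1 : ‖g‖ * ‖g‖ ≤ ‖g‖ * (‖Φ - F‖ * ‖(f : LpCircle (Vec n) 2)‖) := by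
      rw [← inner_self_eq_norm_mul_norm (𝕜 := ℂ), inner_mulOp_eq_inner_mulOp_sub Φ F.2 f.2 hf]
      exact (re_inner_le_norm _ _).trans
        (mul_le_mul_of_nonneg_left (norm_mulOp_apply_le _ _) (norm_nonneg _))
    have h2 : ‖g‖ ≤ ‖Φ - F‖ * ‖(f : LpCircle (Vec n) 2)‖ := by
      rcases (norm_nonneg g).eq_or_lt with h0 | h0
      · rw [← h0]; positivity
      · exact le_of_mul_le_mul_left h1 h0
    exact hΦc.trans (le_of_mul_le_mul_right (hlow.trans h2) hf0)
  · refine (ciInf_le ⟨0, ?_⟩ (0 : hardy (Mat m n) ∞)).trans (by simp)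
    rintro _ ⟨F, rfl⟩
    exact norm_nonneg _

end Sufficiency

/-! ### The coupling of `H²` and `H²₋` through a Hankel operator -/

section Abstract

variable {X Y : Type} [NormedAddCommGroup X] [InnerProductSpace ℂ X] [NormedAddCommGroup Y]
  [InnerProductSpace ℂ Y]

/-- The semi-inner product on `X × Y` in which both factors carry `s` times their own inner product
and the angle between them is given by an operator `Γ : X → Y`. It is positive semidefinite because
`‖Γ‖ ≤ s`. -/
@[reducible]
noncomputable def couplingCore (Γ : X →L[ℂ] Y) {s : ℝ} (hs : ‖Γ‖ ≤ s) :
    PreInnerProductSpace.Core ℂ (X × Y) where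
  inner p q := s * ⟪p.1, q.1⟫_ℂ + s * ⟪p.2, q.2⟫_ℂ + ⟪p.2, Γ q.1⟫_ℂ + ⟪Γ p.1, q.2⟫_ℂ
  conj_inner_symm p q := by
    simp only [map_add, map_mul, inner_conj_symm, Complex.conj_ofReal]
    ring
  re_inner_nonneg p := by
    have h1 : ‖⟪p.2, Γ p.1⟫_ℂ‖ ≤ ‖p.2‖ * (s * ‖p.1‖) :=
      (norm_inner_le_norm _ _).trans
        (mul_le_mul_of_nonneg_left (Γ.le_of_opNorm_le hs _) (norm_nonneg _))
    have h2 := (Complex.abs_re_le_norm _).trans h1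
    have h3 : (⟪Γ p.1, p.2⟫_ℂ).re = (⟪p.2, Γ p.1⟫_ℂ).re := inner_re_symm (𝕜 := ℂ) _ _
    have h4 : (⟪p.1, p.1⟫_ℂ).re = ‖p.1‖ ^ 2 := inner_self_eq_norm_sq (𝕜 := ℂ) _
    have h5 : (⟪p.2, p.2⟫_ℂ).re = ‖p.2‖ ^ 2 := inner_self_eq_norm_sq (𝕜 := ℂ) _
    simp only [RCLike.re_eq_complex_re, Complex.add_re, Complex.re_ofReal_mul, h3, h4, h5]
    have h6 := (abs_le.1 h2).1
    have hs0 : 0 ≤ s := (norm_nonneg _).trans hs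
    nlinarith [mul_nonneg hs0 (sq_nonneg (‖p.1‖ - ‖p.2‖))]
  add_left p q r := by
    simp only [Prod.fst_add, Prod.snd_add, map_add, inner_add_left]
    ring
  smul_left p q c := by
    simp only [Prod.smul_fst, Prod.smul_snd, map_smul, inner_smul_left]
    ring

/-- Let `Γ` intertwine an isometry `S` of `X` with the adjoint of an isometry `R` of `Y`, as a
Hankel operator does with the shifts, and let `E` and `F` be wandering for `S` and `R`. If
`‖Γ‖ ≤ s`, then `E` and `F` map to a Hilbert space that has a contraction `W` whose powers keep
each of them orthogonal to itself, while the matrix entries of the positive powers between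
them are those of `Γ`. The negative powers provide the remaining diagonals of a Laurent
matrix that extends `Γ`. -/
theorem exists_coupling {E F : Type} [NormedAddCommGroup E] [InnerProductSpace ℂ E]
    [NormedAddCommGroup F] [InnerProductSpace ℂ F] (Γ : X →L[ℂ] Y) {s : ℝ} (hs : ‖Γ‖ ≤ s)
    (S : X →ₗᵢ[ℂ] X) (R : Y →ₗᵢ[ℂ] Y) (hΓ : ∀ x y, ⟪R y, Γ x⟫_ℂ = ⟪y, Γ (S x)⟫_ℂ)
    (A : ℕ → E →ₗ[ℂ] X) (hA : ∀ j e, S (A j e) = A (j + 1) e)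
    (hA' : ∀ j e e', ⟪A 0 e, A j e'⟫_ℂ = if j = 0 then ⟪e, e'⟫_ℂ else 0)
    (B : ℕ → F →ₗ[ℂ] Y) (hB : ∀ j d, R (B j d) = B (j + 1) d)
    (hB' : ∀ j d d', ⟪B 0 d, B j d'⟫_ℂ = if j = 0 then ⟪d, d'⟫_ℂ else 0) :
    ∃ (K : Type) (_ : NormedAddCommGroup K) (_ : InnerProductSpace ℂ K) (_ : CompleteSpace K)
      (W : K →L[ℂ] K) (u : E →ₗ[ℂ] K) (v : F →ₗ[ℂ] K), ‖W‖ ≤ 1 ∧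
      (∀ k e e', ⟪u e, dilPow W k (u e')⟫_ℂ = if k = 0 then s * ⟪e, e'⟫_ℂ else 0) ∧
      (∀ k d d', ⟪v d, dilPow W k (v d')⟫_ℂ = if k = 0 then s * ⟪d, d'⟫_ℂ else 0) ∧
      (∀ (k : ℕ) e d, ⟪v d, dilPow W k (u e)⟫_ℂ = ⟪B 0 d, Γ (A k e)⟫_ℂ) := by
  obtain ⟨K, i1, i2, i3, ι, hι⟩ := exists_hilbertSpace_of_preInnerCore (couplingCore Γ hs)
  have hι' : ∀ p q, ⟪ι p, ι q⟫_ℂ = s * ⟪p.1, q.1⟫_ℂ + s * ⟪p.2, q.2⟫_ℂ +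
    ⟪p.2, Γ q.1⟫_ℂ + ⟪Γ p.1, q.2⟫_ℂ := hι
  -- `W` maps `(x, R y)` to `(S x, y)`, isometrically by `hΓ`
  let a := ι ∘ₗ LinearMap.prodMap LinearMap.id R.toLinearMap
  let b := ι ∘ₗ LinearMap.prodMap S.toLinearMap LinearMap.id
  have ha : ∀ p, a p = ι (p.1, R p.2) := fun p => rfl
  have hb : ∀ p, b p = ι (S p.1, p.2) := fun p => rfl
  have hab : ∀ p, ‖b p‖ = ‖a p‖ := fun p => by
    have h : ⟪b p, b p⟫_ℂ = ⟪a p, a p⟫_ℂ := by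
      rw [ha, hb, hι', hι']
      dsimp only
      rw [S.inner_map_map, R.inner_map_map, ← hΓ, ← inner_conj_symm (Γ (S p.1)), ← hΓ,
        inner_conj_symm]
    rw [@norm_eq_sqrt_re_inner ℂ, @norm_eq_sqrt_re_inner ℂ, h]
  obtain ⟨W, hW, hWab⟩ := exists_contraction_of_norm_eq a b hab
  have hWab' : ∀ p, adjoint W (b p) = a p := fun p => by
    rw [← hWab]
    exact adjoint_apply_of_norm_eq hW (by rw [hWab, hab])
  let U : ℕ → E →ₗ[ℂ] K := fun j => ι ∘ₗ LinearMap.inl ℂ _ _ ∘ₗ A j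
  let V : ℕ → F →ₗ[ℂ] K := fun j => ι ∘ₗ LinearMap.inr ℂ _ _ ∘ₗ B j
  have hU : ∀ j e, U j e = ι (A j e, 0) := fun j e => rfl
  have hV : ∀ j d, V j d = ι (0, B j d) := fun j d => rfl
  have hWU : ∀ (k : ℕ) e, dilPow W k (U 0 e) = U k e := fun k e => by
    rw [dilPow_natCast]
    induction k with
    | zero => rfl
    | succ k ih =>
      have := hWab (A k e, 0)
      rw [ha, hb, map_zero, hA] at this
      rw [pow_succ', mul_apply_eq_comp, ih, hU, this, hU]
  have hWV : ∀ (k : ℕ) d, dilPow W (-k) (V 0 d) = V k d := fun k d => by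
    rw [dilPow_neg_natCast]
    induction k with
    | zero => rfl
    | succ k ih =>
      have := hWab' (0, B k d)
      rw [ha, hb, map_zero, hB] at this
      rw [pow_succ', mul_apply_eq_comp, ih, hV, this, hV]
  have hUU : ∀ (k : ℕ) e e', ⟪U 0 e, U k e'⟫_ℂ = if k = 0 then s * ⟪e, e'⟫_ℂ else 0 :=
    fun k e e' => by simp [hU, hι', hA']
  have hVV : ∀ (k : ℕ) d d', ⟪V 0 d, V k d'⟫_ℂ = if k = 0 then s * ⟪d, d'⟫_ℂ else 0 :=
    fun k d d' => by simp [hV, hι', hB']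
  refine ⟨K, i1, i2, i3, W, U 0, V 0, hW, fun k e e' => ?_, fun k d d' => ?_, fun k e d => ?_⟩
  · obtain ⟨j, rfl | rfl⟩ := k.eq_nat_or_neg
    · simp [hWU, hUU]
    · rw [inner_dilPow_neg, ← inner_conj_symm, hWU, hUU]
      split_ifs <;> simp_all
  · obtain ⟨j, rfl | rfl⟩ := k.eq_nat_or_neg
    · rw [← neg_neg (j : ℤ), inner_dilPow_neg, ← inner_conj_symm, hWV, hVV]
      split_ifs <;> simp_all
    · simp [hWV, hVV]
  · rw [hWU]
    simp [hU, hV, hι']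

end Abstract

section Coupling

variable {m n : ℕ}

/-- The shift on `H²`. -/
noncomputable def hardyShift (n : ℕ) : hardy (Vec n) 2 →ₗᵢ[ℂ] hardy (Vec n) 2 where
  toLinearMap := (shift 1).toLinearMap.restrict fun _ => shift_mem_hardy zero_le_one
  norm_map' f := (shift 1).norm_map (f : LpCircle (Vec n) 2)

/-- The backward shift on `H²₋`. -/
noncomputable def coShift (n : ℕ) : ↥(hardy (Vec n) 2)ᗮ →ₗᵢ[ℂ] ↥(hardy (Vec n) 2)ᗮ where
  toLinearMap := (shift (-1)).toLinearMap.restrict fun _ => shift_neg_one_mem_orthogonal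
  norm_map' f := (shift (-1)).norm_map (f : LpCircle (Vec n) 2)

/-- `x ↦ ζ ^ j x` as a map into `H²`, for `j ≥ 0`. -/
noncomputable def hardyMono (n : ℕ) (j : ℕ) : Vec n →ₗ[ℂ] hardy (Vec n) 2 where
  toFun x := ⟨mono j x, mono_mem_hardy (Int.natCast_nonneg j) x⟩
  map_add' x y := Subtype.ext (mono_add _ x y)
  map_smul' c x := Subtype.ext (mono_smul _ c x)

/-- `x ↦ ζ ^ (-1 - j) x` as a map into `H²₋`, for `j ≥ 0`. -/
noncomputable def coMono (n : ℕ) (j : ℕ) : Vec n →ₗ[ℂ] ↥(hardy (Vec n) 2)ᗮ where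
  toFun x := ⟨mono (-1 - j) x, mono_mem_orthogonal (by omega) x⟩
  map_add' x y := Subtype.ext (mono_add _ x y)
  map_smul' c x := Subtype.ext (mono_smul _ c x)

theorem hardyShift_hardyMono (j : ℕ) (x : Vec n) :
    hardyShift n (hardyMono n j x) = hardyMono n (j + 1) x :=
  Subtype.ext <| by
    change shift 1 (mono j x) = mono ((j + 1 : ℕ) : ℤ) x
    rw [shift_mono, Nat.cast_add, Nat.cast_one, add_comm]

theorem coShift_coMono (j : ℕ) (x : Vec n) :
    coShift n (coMono n j x) = coMono n (j + 1) x :=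
  Subtype.ext <| by
    change shift (-1) (mono (-1 - j) x) = mono (-1 - ((j + 1 : ℕ) : ℤ)) x
    rw [shift_mono, Nat.cast_add, Nat.cast_one]
    congr 1
    ring

theorem inner_hardyMono (k : ℕ) (x y : Vec n) :
    ⟪hardyMono n 0 x, hardyMono n k y⟫_ℂ = if k = 0 then ⟪x, y⟫_ℂ else 0 := by
  change ⟪mono (0 : ℕ) x, mono k y⟫_ℂ = _
  rw [inner_mono_mono]
  congr 1
  exact propext (by omega)

theorem inner_coMono (k : ℕ) (x y : Vec n) :
    ⟪coMono n 0 x, coMono n k y⟫_ℂ = if k = 0 then ⟪x, y⟫_ℂ else 0 := by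
  change ⟪mono (-1 - (0 : ℕ)) x, mono (-1 - k) y⟫_ℂ = _
  rw [inner_mono_mono]
  congr 1
  exact propext (by omega)

theorem inner_coShift_hankel (Φ : LpCircle (Mat m n) ∞) (f : hardy (Vec n) 2)
    (g : ↥(hardy (Vec m) 2)ᗮ) :
    ⟪coShift m g, hankel Φ f⟫_ℂ = ⟪g, hankel Φ (hardyShift n f)⟫_ℂ := by
  rw [inner_hankel, inner_hankel]
  change ⟪shift (-1) (g : LpCircle (Vec m) 2), mulOp Φ f⟫_ℂ =
    ⟪(g : LpCircle (Vec m) 2), mulOp Φ (shift 1 (f : LpCircle (Vec n) 2))⟫_ℂ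
  rw [inner_shift_left, mulOp_shift, neg_neg]

theorem inner_coMono_hankel (Φ : LpCircle (Mat m n) ∞) (k : ℕ) (x : Vec n) (y : Vec m) :
    ⟪coMono m 0 y, hankel Φ (hardyMono n k x)⟫_ℂ =
      ⟪y, matAct m n (fourierCoeff Φ (-1 - k)) x⟫_ℂ := by
  rw [inner_hankel]
  change ⟪mono (-1 - (0 : ℕ)) y, mulOp Φ (mono k x)⟫_ℂ = _
  rw [inner_mono_left, fourierCoeff_mulOp_mono, Nat.cast_zero, sub_zero]

end Coupling

/-! ### The symbol of a Toeplitz kernel -/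

section Symbol

variable {K E F : Type*} [NormedAddCommGroup K] [InnerProductSpace ℂ K] [CompleteSpace K]
  [NormedAddCommGroup E] [InnerProductSpace ℂ E] [NormedAddCommGroup F] [InnerProductSpace ℂ F]
  {W : K →L[ℂ] K} {u : E →ₗ[ℂ] K} {v : F →ₗ[ℂ] K} {s : ℝ}

/-- The positivity of the Toeplitz kernel, tested on the vectors `γ i • u e + δ i • v d`. -/
theorem re_sum_coupling_nonneg (hW : ‖W‖ ≤ 1)
    (hu : ∀ k e e', ⟪u e, dilPow W k (u e')⟫_ℂ = if k = 0 then s * ⟪e, e'⟫_ℂ else 0)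
    (hv : ∀ k d d', ⟪v d, dilPow W k (v d')⟫_ℂ = if k = 0 then s * ⟪d, d'⟫_ℂ else 0)
    (e : E) (d : F) (γ δ : ℤ → ℂ) (S : Finset ℤ) :
    0 ≤ s * ‖e‖ ^ 2 * ∑ i ∈ S, ‖γ i‖ ^ 2 + s * ‖d‖ ^ 2 * ∑ i ∈ S, ‖δ i‖ ^ 2 +
      2 * (∑ i ∈ S, ∑ j ∈ S, conj (δ j) * γ i * ⟪v d, dilPow W (i - j) (u e)⟫_ℂ).re := by
  set c : ℤ → ℂ := fun k => ⟪v d, dilPow W k (u e)⟫_ℂ with hc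
  have hc' : ∀ k, ⟪u e, dilPow W k (v d)⟫_ℂ = conj (c (-k)) := fun k => by
    rw [hc]
    dsimp only
    rw [inner_dilPow_neg, inner_conj_symm]
  have hc'' : ∀ k, ⟪v d, dilPow W k (u e)⟫_ℂ = c k := fun _ => rfl
  simp only [hc'']
  have h1 := re_sum_inner_dilPow_nonneg hW (fun i => γ i • u e + δ i • v d) S
  have h2 : ∑ i ∈ S, ∑ j ∈ S, ⟪γ j • u e + δ j • v d, dilPow W (i - j) (γ i • u e + δ i • v d)⟫_ℂ =
      ((s * ‖e‖ ^ 2 * ∑ i ∈ S, ‖γ i‖ ^ 2 + s * ‖d‖ ^ 2 * ∑ i ∈ S, ‖δ i‖ ^ 2 : ℝ) : ℂ) +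
      (∑ i ∈ S, ∑ j ∈ S, conj (δ j) * γ i * c (i - j) +
        conj (∑ i ∈ S, ∑ j ∈ S, conj (δ j) * γ i * c (i - j))) := by
    have h3 : ∀ i j, ⟪γ j • u e + δ j • v d, dilPow W (i - j) (γ i • u e + δ i • v d)⟫_ℂ =
        (if i = j then ((s * ‖e‖ ^ 2 * ‖γ i‖ ^ 2 + s * ‖d‖ ^ 2 * ‖δ i‖ ^ 2 : ℝ) : ℂ) else 0) +
        (conj (δ j) * γ i * c (i - j) + conj (conj (δ i) * γ j * c (j - i))) := fun i j => by
      simp only [map_add, map_smul, inner_add_left, inner_add_right, inner_smul_left,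
        inner_smul_right, hu, hv, hc', hc'', neg_sub, sub_eq_zero, inner_self_eq_norm_sq_to_K,
        map_mul, Complex.conj_conj]
      split_ifs with h
      · subst h
        have e1 : (‖γ i‖ : ℂ) ^ 2 = conj (γ i) * γ i := (Complex.conj_mul' _).symm
        have e2 : (‖δ i‖ : ℂ) ^ 2 = conj (δ i) * δ i := (Complex.conj_mul' _).symm
        push_cast
        rw [e1, e2]
        simp only [Complex.coe_algebraMap]
        ring
      · ring
    simp only [h3, Finset.sum_add_distrib, map_sum, map_mul]
    congr 1
    · simp only [Finset.sum_ite_eq]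
      rw [Finset.sum_congr rfl fun i hi => if_pos hi, Complex.ofReal_add, Finset.mul_sum,
        Finset.mul_sum, Complex.ofReal_sum, Complex.ofReal_sum, ← Finset.sum_add_distrib]
      simp
    · rw [Finset.sum_comm (f := fun i j => conj (conj (δ i)) * conj (γ j) * conj (c (j - i)))]
  rwa [h2, Complex.add_conj, ← Complex.ofReal_add, RCLike.re_eq_complex_re, Complex.ofReal_re] at h1

/-- A row of a bounded Laurent matrix is square summable. -/
theorem sum_sq_norm_coupling_le (hs : 0 ≤ s) (hW : ‖W‖ ≤ 1)
    (hu : ∀ k e e', ⟪u e, dilPow W k (u e')⟫_ℂ = if k = 0 then s * ⟪e, e'⟫_ℂ else 0)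
    (hv : ∀ k d d', ⟪v d, dilPow W k (v d')⟫_ℂ = if k = 0 then s * ⟪d, d'⟫_ℂ else 0)
    {e : E} (he : ‖e‖ = 1) {d : F} (hd : ‖d‖ = 1) (S : Finset ℤ) :
    ∑ k ∈ S, ‖⟪v d, dilPow W k (u e)⟫_ℂ‖ ^ 2 ≤ s * (s + 1) := by
  set c : ℤ → ℂ := fun k => ⟪v d, dilPow W k (u e)⟫_ℂ with hc
  set S' := insert 0 S with hS'
  -- test on `u e` at the index `0` and on a multiple of the row itself
  have h0 : (0 : ℤ) ∈ S' := Finset.mem_insert_self _ _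
  set t : ℝ := (s + 1)⁻¹ with ht
  have h1 := re_sum_coupling_nonneg hW hu hv e d (fun i => -t * conj (c i)) (Pi.single 0 1) S'
  have h2 : ∑ i ∈ S', ‖-(t : ℂ) * conj (c i)‖ ^ 2 = t ^ 2 * ∑ i ∈ S', ‖c i‖ ^ 2 := by
    rw [Finset.mul_sum]
    refine Finset.sum_congr rfl fun i _ => ?_
    rw [norm_mul, norm_neg, Complex.norm_real, RCLike.norm_conj, mul_pow, Real.norm_eq_abs, sq_abs]
  have h3 : ∑ i ∈ S', ‖(Pi.single 0 1 : ℤ → ℂ) i‖ ^ 2 = 1 := by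
    rw [Finset.sum_eq_single_of_mem 0 h0 fun i _ hi => by simp [hi]]
    simp
  have h4 : ∑ i ∈ S', ∑ j ∈ S', conj ((Pi.single 0 1 : ℤ → ℂ) j) * (-t * conj (c i)) * c (i - j) =
      ((-t * ∑ i ∈ S', ‖c i‖ ^ 2 : ℝ) : ℂ) := by
    push_cast
    rw [Finset.mul_sum]
    refine Finset.sum_congr rfl fun i _ => ?_
    rw [Finset.sum_eq_single_of_mem 0 h0 fun j _ hj => by simp [hj], ← Complex.conj_mul']
    simp only [Pi.single_eq_same, map_one, sub_zero]
    ring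
  have h5 : ∑ k ∈ S, ‖c k‖ ^ 2 ≤ ∑ k ∈ S', ‖c k‖ ^ 2 :=
    Finset.sum_le_sum_of_subset_of_nonneg (Finset.subset_insert _ _) fun _ _ _ => sq_nonneg _
  refine h5.trans ?_
  change 0 ≤ _ + _ + 2 * (∑ i ∈ S', ∑ j ∈ S',
    conj ((Pi.single 0 1 : ℤ → ℂ) j) * (-t * conj (c i)) * c (i - j)).re at h1
  rw [h2, h3, h4, he, hd, Complex.ofReal_re] at h1
  set σ := ∑ i ∈ S', ‖c i‖ ^ 2
  have hσ : 0 ≤ σ := Finset.sum_nonneg fun _ _ => sq_nonneg _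
  have hts : t * (s + 1) = 1 := inv_mul_cancel₀ (by positivity)
  have ht0 : 0 < t := by positivity
  have h6 : t * σ ≤ s := by
    have : s * t ^ 2 = t - t ^ 2 := by linear_combination t * hts
    nlinarith [mul_nonneg (sq_nonneg t) hσ]
  have := mul_le_mul_of_nonneg_right h6 (by positivity : 0 ≤ s + 1)
  calc σ = t * (s + 1) * σ := by rw [hts, one_mul]
    _ = t * σ * (s + 1) := by ring
    _ ≤ _ := this

end Symbol

/-! ### Nehari's theorem for matrix functions -/

section Nehari

variable {m n : ℕ}

/-- A quadratic-form criterion for `‖A‖ ≤ s`. The unimodular factor `z` is harmless, as `y` may be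
rotated. -/
theorem norm_le_of_forall_nonneg {A : Mat m n} {s : ℝ} {z : ℂ} (hs : 0 ≤ s) (hz : ‖z‖ = 1)
    (h : ∀ x y, 0 ≤ s * ‖x‖ ^ 2 + s * ‖y‖ ^ 2 + 2 * (z * ⟪y, matAct m n A x⟫_ℂ).re) :
    ‖A‖ ≤ s := by
  rw [← norm_matAct]
  refine opNorm_le_bound _ hs fun x => ?_
  set w := matAct m n A x with hw
  rcases (norm_nonneg w).eq_or_lt with h0 | h0
  · rw [← h0]; positivity
  have hx : 0 < ‖x‖ := norm_pos_iff.2 fun hx => by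
    rw [hw, hx, map_zero, norm_zero] at h0
    exact h0.false
  -- the choice of `y` that makes the last term as negative as possible, at length `‖x‖`
  set r := ‖x‖ / ‖w‖ with hr
  have hrw : r * ‖w‖ = ‖x‖ := div_mul_cancel₀ _ h0.ne'
  have h1 := h x ((-(r : ℂ) * z) • w)
  have h2 : z * ⟪(-(r : ℂ) * z) • w, w⟫_ℂ = ((-(r * ‖w‖ * ‖w‖) : ℝ) : ℂ) := by
    have hzz : z * conj z = 1 := by rw [Complex.mul_conj', hz]; simp
    rw [inner_smul_left, inner_self_eq_norm_sq_to_K, map_mul, map_neg, Complex.conj_ofReal]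
    push_cast
    simp only [Complex.coe_algebraMap]
    linear_combination (-(r : ℂ) * ‖w‖ ^ 2) * hzz
  have h3 : ‖(-(r : ℂ) * z) • w‖ = ‖x‖ := by
    rw [norm_smul, norm_mul, norm_neg, hz, mul_one, Complex.norm_real, Real.norm_of_nonneg
      (by positivity), hrw]
  rw [h2, h3, Complex.ofReal_re, hrw] at h1
  refine le_of_mul_le_mul_left ?_ hx
  linarith

/-- The Riesz–Fischer theorem. -/
theorem exists_fourierCoeff_eq {c : ℤ → ℂ} {C : ℝ} (hc : ∀ S : Finset ℤ, ∑ k ∈ S, ‖c k‖ ^ 2 ≤ C) :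
    ∃ G : LpCircle ℂ 2, ∀ k, fourierCoeff G k = c k := by
  have h : Memℓp c 2 := memℓp_gen' (C := C) fun S => by
    simpa using hc S
  refine ⟨fourierBasis.repr.symm ⟨c, h⟩, fun k => ?_⟩
  rw [← fourierBasis_repr, LinearIsometryEquiv.apply_symm_apply]

theorem inner_matAct_eq_sum (A : Mat m n) (x : Vec n) (y : Vec m) :
    ⟪y, matAct m n A x⟫_ℂ = ∑ i, ∑ j, conj (y i) * x j * A i j := by
  rw [matAct_apply, PiLp.inner_apply]
  refine Finset.sum_congr rfl fun i _ => ?_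
  simp only [RCLike.inner_apply, Matrix.mulVec, dotProduct, Finset.sum_mul]
  exact Finset.sum_congr rfl fun j _ => by ring

theorem eq_of_forall_inner_matAct {A B : Mat m n}
    (h : ∀ x y, ⟪y, matAct m n A x⟫_ℂ = ⟪y, matAct m n B x⟫_ℂ) : A = B := by
  have h1 : matAct m n A = matAct m n B := by
    ext1 x
    exact ext_inner_left ℂ fun y => h x y
  rw [← sub_eq_zero, ← norm_eq_zero, ← norm_matAct, map_sub, h1, sub_self, norm_zero]

/-- A sesquilinear form on Euclidean spaces is determined by its matrix. -/
theorem sum_inner_single {K : Type*} [NormedAddCommGroup K] [InnerProductSpace ℂ K]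
    (u : Vec n →ₗ[ℂ] K) (v : Vec m →ₗ[ℂ] K) (D : K →L[ℂ] K) (x : Vec n) (y : Vec m) :
    ⟪v y, D (u x)⟫_ℂ = ∑ i, ∑ j, conj (y i) * x j *
      ⟪v (EuclideanSpace.single i 1), D (u (EuclideanSpace.single j 1))⟫_ℂ := by
  have hx : x = ∑ j, x j • EuclideanSpace.single j (1 : ℂ) := by
    simpa using ((EuclideanSpace.basisFun (Fin n) ℂ).sum_repr x).symm
  have hy : y = ∑ i, y i • EuclideanSpace.single i (1 : ℂ) := by
    simpa using ((EuclideanSpace.basisFun (Fin m) ℂ).sum_repr y).symm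
  conv_lhs => rw [hx, hy]
  simp only [map_sum, map_smul, sum_inner, inner_sum, inner_smul_left, inner_smul_right,
    Finset.mul_sum]
  rw [Finset.sum_comm]
  exact Finset.sum_congr rfl fun i _ => Finset.sum_congr rfl fun j _ => by ring

/-- **Nehari's theorem** for matrix functions, due to Page: the distance from `Φ` to `H^∞` is at
most `‖H_Φ‖`, and an `F` within that distance exists. -/
theorem exists_mem_hardy_norm_sub_le (Φ : LpCircle (Mat m n) ∞) :
    ∃ F ∈ hardy (Mat m n) ∞, ‖Φ - F‖ ≤ ‖hankel Φ‖ := by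
  set s := ‖hankel Φ‖ with hs
  have hs0 : 0 ≤ s := norm_nonneg (hankel Φ)
  obtain ⟨K, i1, i2, i3, W, u, v, hW, hu, hv, huv⟩ := exists_coupling (hankel Φ) hs.ge
    (hardyShift n) (coShift m) (fun f g => inner_coShift_hankel Φ f g) (hardyMono n)
    hardyShift_hardyMono inner_hardyMono (coMono m) coShift_coMono inner_coMono
  -- The symbol `Ψ`, by its entries. The index is `-1 - k`, as `v` embeds `ℂᵐ` in `H²₋` by
  -- `y ↦ ζ⁻¹ y`.
  have hG : ∀ i j, ∃ G : LpCircle ℂ 2, ∀ k, fourierCoeff G k =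
      ⟪v (EuclideanSpace.single i 1), dilPow W (-1 - k) (u (EuclideanSpace.single j 1))⟫_ℂ :=
    fun i j => by
      refine exists_fourierCoeff_eq (C := s * (s + 1)) fun S => ?_
      have := sum_sq_norm_coupling_le hs0 hW hu hv
        (e := EuclideanSpace.single j 1) (by simp) (d := EuclideanSpace.single i 1) (by simp)
        (S.map (Equiv.subLeft (-1 : ℤ)).toEmbedding)
      simpa [Finset.sum_map] using this
  choose G hG using hG
  let Ψ : AddCircle (1 : ℝ) → Mat m n :=
    fun t => ∑ p : Fin m × Fin n, G p.1 p.2 t • Matrix.single p.1 p.2 1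
  have hΨint : Integrable Ψ 𝔪 :=
    integrable_finsetSum _ fun p _ => (integrable_lpCircle (G p.1 p.2)).smul_const _
  have hΨk : ∀ k i j, fourierCoeff Ψ k i j = fourierCoeff (G i j) k := fun k i j => by
    have h1 : fourierCoeff Ψ k =
        ∑ p : Fin m × Fin n, fourierCoeff (G p.1 p.2) k • Matrix.single p.1 p.2 (1 : ℂ) := by
      simp only [fourierCoeff, Ψ, Finset.smul_sum]
      rw [integral_finsetSum]
      · refine Finset.sum_congr rfl fun p _ => ?_
        rw [← integral_smul_const]
        simp only [smul_assoc]
      · exact fun p _ => ((integrable_lpCircle (G p.1 p.2)).smul_const _).fourier_smul _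
    rw [h1, Matrix.sum_apply, Finset.sum_eq_single (i, j)]
    · simp
    · rintro ⟨i', j'⟩ - hne
      rw [Matrix.smul_apply, Matrix.single_apply_of_ne, smul_zero]
      rintro ⟨rfl, rfl⟩
      exact hne rfl
    · simp
  have hΨ : ∀ k x y, ⟪y, matAct m n (fourierCoeff Ψ k) x⟫_ℂ = ⟪v y, dilPow W (-1 - k) (u x)⟫_ℂ :=
    fun k x y => by
      rw [inner_matAct_eq_sum, sum_inner_single]
      simp only [hΨk, hG]
  -- the Toeplitz kernel of `W` is positive, hence so is its symbol; the factor `ζ`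
  -- makes up for the shift of the index by one
  have hpos : ∀ x y, ∀ᵐ t ∂𝔪,
      0 ≤ s * ‖x‖ ^ 2 + s * ‖y‖ ^ 2 + 2 * (fourier 1 t * ⟪y, matAct m n (Ψ t) x⟫_ℂ).re :=
    fun x y => by
      set a : ℝ := s * ‖x‖ ^ 2 + s * ‖y‖ ^ 2 with ha
      have hg1 : Integrable (fun t => ⟪y, matAct m n (Ψ t) x⟫_ℂ) 𝔪 :=
        ((innerSL ℂ y).comp (matActFlip m x)).integrable_comp hΨint
      have hg2 : Integrable (fun t => 2 * (fourier 1 t * ⟪y, matAct m n (Ψ t) x⟫_ℂ)) 𝔪 :=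
        (hg1.fourier_smul 1).const_mul 2
      have hg : Integrable (fun t => (a : ℂ) + 2 * (fourier 1 t * ⟪y, matAct m n (Ψ t) x⟫_ℂ)) 𝔪 :=
        (integrable_const _).add hg2
      have hgk : ∀ k, fourierCoeff
          (fun t => (a : ℂ) + 2 * (fourier 1 t * ⟪y, matAct m n (Ψ t) x⟫_ℂ)) k =
          (if k = 0 then (a : ℂ) else 0) + 2 * ⟪v y, dilPow W (-k) (u x)⟫_ℂ := fun k => by
        have h1 := fourierCoeff.add (integrable_const (a : ℂ)) hg2
        have h2 : fourierCoeff (fun t => 2 * (fourier 1 t * ⟪y, matAct m n (Ψ t) x⟫_ℂ)) k =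
            2 * ⟪v y, dilPow W (-k) (u x)⟫_ℂ := by
          rw [fourierCoeff.const_mul, show -k = -1 - (k - 1) by ring, ← hΨ,
            ← fourierCoeff_matAct hΨint, fourierCoeff, fourierCoeff, ← integral_inner]
          · congr 1
            refine integral_congr_ae (Eventually.of_forall fun t => ?_)
            simp only [inner_smul_right, smul_eq_mul]
            rw [← mul_assoc, ← fourier_add, show -(k - 1) = -k + 1 by ring]
          · exact ((matActFlip m x).integrable_comp hΨint).fourier_smul _
        rw [← h2, ← fourierCoeff_const (a : ℂ) k]
        exact congr_fun h1 k
      have hS : ∀ (S : Finset ℤ) (c : ℤ → ℂ), 0 ≤ (∑ i ∈ S, ∑ j ∈ S, conj (c j) * c i *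
          fourierCoeff (fun t => (a : ℂ) + 2 * (fourier 1 t * ⟪y, matAct m n (Ψ t) x⟫_ℂ))
            (j - i)).re := fun S c => by
        have h := re_sum_coupling_nonneg hW hu hv x y c c S
        simp only [hgk, sub_eq_zero, mul_add, Finset.sum_add_distrib, neg_sub]
        rw [Complex.add_re]
        convert h using 2
        · have : ∀ i ∈ S, (∑ j ∈ S, conj (c j) * c i * if j = i then (a : ℂ) else 0) =
              ((a * ‖c i‖ ^ 2 : ℝ) : ℂ) := fun i hi => by
            rw [Finset.sum_eq_single_of_mem i hi fun j _ hj => by simp [hj], if_pos rfl,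
              Complex.conj_mul']
            push_cast
            ring
          rw [Finset.sum_congr rfl this, ← Complex.ofReal_sum, Complex.ofReal_re, ← Finset.mul_sum,
            ha, add_mul]
        · rw [← Complex.re_ofReal_mul, Finset.mul_sum]
          simp only [Finset.mul_sum]
          congr 1
          refine Finset.sum_congr rfl fun i _ => Finset.sum_congr rfl fun j _ => ?_
          push_cast
          ring
      filter_upwards [ae_nonneg_re_of_toeplitz_nonneg hg hS] with t ht
      simpa using ht
  -- the exceptional null set is made independent of `x` and `y` by density
  have hbound : ∀ᵐ t ∂𝔪, ‖Ψ t‖ ≤ s := by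
    have h1 := ae_all_iff.2 fun k => hpos (TopologicalSpace.denseSeq (Vec n × Vec m) k).1
      (TopologicalSpace.denseSeq (Vec n × Vec m) k).2
    filter_upwards [h1] with t ht
    refine norm_le_of_forall_nonneg hs0 (norm_fourier_apply 1 t) fun x y => ?_
    refine (TopologicalSpace.denseRange_denseSeq (Vec n × Vec m)).induction_on
      (p := fun q : Vec n × Vec m => 0 ≤ s * ‖q.1‖ ^ 2 + s * ‖q.2‖ ^ 2 +
        2 * (fourier 1 t * ⟪q.2, matAct m n (Ψ t) q.1⟫_ℂ).re) (x, y)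
      (isClosed_le continuous_const ?_) ht
    fun_prop
  have hmem : MemLp Ψ ∞ 𝔪 := memLp_top_of_bound hΨint.aestronglyMeasurable s hbound
  -- `Φ - Ψ` is analytic: on negative indices the powers of `W` reproduce the entries of `H_Φ`
  refine ⟨Φ - hmem.toLp, fun k hk => ?_, ?_⟩
  · have h1 : fourierCoeff (Φ - hmem.toLp : LpCircle (Mat m n) ∞) k =
        fourierCoeff Φ k - fourierCoeff Ψ k := by
      rw [eq_sub_iff_add_eq, ← fourierCoeff_congr_ae hmem.coeFn_toLp,
        ← Pi.add_apply (fourierCoeff (Φ - hmem.toLp : LpCircle (Mat m n) ∞)),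
        ← fourierCoeff.add (integrable_lpCircle _) (integrable_lpCircle _),
        ← fourierCoeff_congr_ae (Lp.coeFn_add _ _), sub_add_cancel]
    rw [h1, sub_eq_zero]
    refine eq_of_forall_inner_matAct fun x y => ?_
    obtain ⟨l, hl⟩ := Int.eq_ofNat_of_zero_le (show 0 ≤ -1 - k by omega)
    rw [hΨ, hl]
    refine Eq.trans ?_ (huv l x y).symm
    rw [inner_coMono_hankel, ← show k = -1 - (l : ℤ) by omega]
  · rw [sub_sub_cancel]
    refine (Lp.norm_le_of_ae_bound hs0 ?_).trans (by simp)
    filter_upwards [hmem.coeFn_toLp, hbound] with t h1 h2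
    rwa [h1]

end Nehari

/-! ### Necessity of the conditions -/

section Necessity

variable {m n : ℕ}

/-- Pointwise equality in `‖Φ f‖ ≤ ‖Φ‖ ‖f‖`, when there is equality in norm. -/
theorem ae_norm_matAct_eq {Φ : LpCircle (Mat m n) ∞} {f : LpCircle (Vec n) 2}
    (h : ‖Φ‖ * ‖f‖ ≤ ‖mulOp Φ f‖) : ∀ᵐ t ∂𝔪, ‖matAct m n (Φ t) (f t)‖ = ‖Φ‖ * ‖f t‖ := by
  have hsq : ∀ {k : ℕ} (g : LpCircle (Vec k) 2), Integrable (fun t => ‖g t‖ ^ 2) 𝔪 ∧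
      ‖g‖ ^ 2 = ∫ t, ‖g t‖ ^ 2 ∂𝔪 := fun {k} g => by
    refine ⟨(Lp.memLp g).integrable_norm_pow two_ne_zero, ?_⟩
    have h1 := congrArg RCLike.re (L2.inner_def (𝕜 := ℂ) g g)
    rw [← integral_re (L2.integrable_inner g g)] at h1
    simpa only [inner_self_eq_norm_sq] using h1
  obtain ⟨hf1, hf2⟩ := hsq f
  obtain ⟨hg1, hg2⟩ := hsq (mulOp Φ f)
  have hle : ∀ᵐ t ∂𝔪, ‖mulOp Φ f t‖ ≤ ‖Φ‖ * ‖f t‖ := by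
    filter_upwards [coeFn_mulOp Φ f, ae_norm_le_norm Φ] with t h1 h2
    rw [h1]
    exact ((matAct m n (Φ t)).le_opNorm _).trans
      (mul_le_mul_of_nonneg_right ((norm_matAct _).trans_le h2) (norm_nonneg _))
  have hint : Integrable (fun t => ‖Φ‖ ^ 2 * ‖f t‖ ^ 2 - ‖mulOp Φ f t‖ ^ 2) 𝔪 :=
    (hf1.const_mul _).sub hg1
  have hnn : 0 ≤ᵐ[𝔪] fun t => ‖Φ‖ ^ 2 * ‖f t‖ ^ 2 - ‖mulOp Φ f t‖ ^ 2 := by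
    filter_upwards [hle] with t ht
    have := pow_le_pow_left₀ (norm_nonneg _) ht 2
    rw [mul_pow] at this
    exact sub_nonneg.2 this
  have h0 : ∫ t, (‖Φ‖ ^ 2 * ‖f t‖ ^ 2 - ‖mulOp Φ f t‖ ^ 2) ∂𝔪 = 0 := by
    refine le_antisymm ?_ (integral_nonneg_of_ae hnn)
    rw [integral_sub (hf1.const_mul _) hg1, integral_const_mul, ← hf2, ← hg2, ← mul_pow]
    exact sub_nonpos.2 (pow_le_pow_left₀ (by positivity) h 2)
  filter_upwards [(integral_eq_zero_iff_of_nonneg_ae hnn hint).1 h0, coeFn_mulOp Φ f] with t h1 h2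
  rw [← h2]
  have h3 : (‖Φ‖ * ‖f t‖) ^ 2 = ‖mulOp Φ f t‖ ^ 2 := by
    rw [mul_pow]; exact sub_eq_zero.1 h1
  exact ((pow_left_inj₀ (by positivity) (norm_nonneg _) two_ne_zero).1 h3).symm

/-- A maximizing vector `f` of `H_Φ` is maximizing for `Φ` at almost every point, and lies in the
kernel of `T_Φ`: equality holds throughout `‖H_Φ f‖ ≤ ‖Φ f‖ ≤ ‖Φ‖ ‖f‖`. -/
theorem hasMaximizingKernelFunction_of_badlyApproximable {Φ : LpCircle (Mat m n) ∞}
    (hess : essNorm (hankel Φ) < ‖Φ‖) (hΦ : BadlyApproximable Φ) :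
    HasConstantNorm Φ ∧ HasMaximizingKernelFunction Φ := by
  obtain ⟨F, hF, hFΦ⟩ := exists_mem_hardy_norm_sub_le Φ
  have hle : ‖Φ‖ ≤ ‖hankel Φ‖ := by
    refine hΦ.trans_le ((ciInf_le ⟨0, ?_⟩ (⟨F, hF⟩ : hardy (Mat m n) ∞)).trans hFΦ)
    rintro _ ⟨F, rfl⟩
    exact norm_nonneg _
  obtain ⟨f, hf1, hf⟩ := exists_norm_eq_of_essNorm_lt (hess.trans_le hle)
  have hf1' : ‖(f : LpCircle (Vec n) 2)‖ = 1 := hf1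
  have hfΦ : ‖Φ‖ ≤ ‖hankel Φ f‖ := hle.trans_eq hf.symm
  have hgΦ : ‖mulOp Φ (f : LpCircle (Vec n) 2)‖ ≤ ‖Φ‖ := by
    simpa [hf1'] using norm_mulOp_apply_le Φ (f : LpCircle (Vec n) 2)
  have hpyth : ‖mulOp Φ (f : LpCircle (Vec n) 2)‖ ^ 2 = ‖toeplitz Φ f‖ ^ 2 + ‖hankel Φ f‖ ^ 2 :=
    (hardy (Vec m) 2).norm_sq_eq_add_norm_sq_projection _
  have hT : toeplitz Φ f = 0 := by
    rw [← norm_eq_zero, ← sq_eq_zero_iff]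
    have h1 := pow_le_pow_left₀ (norm_nonneg _) hgΦ 2
    have h2 := pow_le_pow_left₀ (norm_nonneg _) hfΦ 2
    exact le_antisymm (by linarith) (sq_nonneg _)
  have hmul : ‖Φ‖ * ‖(f : LpCircle (Vec n) 2)‖ ≤ ‖mulOp Φ (f : LpCircle (Vec n) 2)‖ := by
    rw [hf1', mul_one]
    refine hfΦ.trans (le_of_sq_le_sq ?_ (norm_nonneg _))
    rw [hpyth]
    exact le_add_of_nonneg_left (sq_nonneg _)
  have hne : ∀ᵐ t ∂𝔪, (f : LpCircle (Vec n) 2) t ≠ 0 :=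
    ae_ne_zero_of_mem_hardy f.2 (norm_ne_zero_iff.1 (by rw [hf1']; exact one_ne_zero))
  have hpt := ae_norm_matAct_eq hmul
  have hnorm : ∀ᵐ t ∂𝔪, ‖Φ t‖ = ‖Φ‖ := by
    filter_upwards [hne, hpt, ae_norm_le_norm Φ] with t h1 h2 h3
    refine le_antisymm h3 (le_of_mul_le_mul_right ?_ (norm_pos_iff.2 h1))
    rw [← h2]
    exact (matAct m n (Φ t)).le_opNorm _
  refine ⟨⟨‖Φ‖, hnorm⟩, f, hT, ?_⟩
  filter_upwards [hne, hpt, hnorm] with t h1 h2 h3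
  exact ⟨h1, by rw [h2, h3]⟩

end Necessity

end BadlyApprox

theorem theorem6p1 (m n : ℕ) (Φ : BadlyApprox.LpCircle (BadlyApprox.Mat m n) ∞) :
    (BadlyApprox.essNorm (BadlyApprox.hankel Φ) < ‖Φ‖ →
      (BadlyApprox.BadlyApproximable Φ ↔
        BadlyApprox.HasConstantNorm Φ ∧ BadlyApprox.HasMaximizingKernelFunction Φ)) ∧
    (BadlyApprox.HasConstantNorm Φ ∧ BadlyApprox.HasMaximizingKernelFunction Φ →
      BadlyApprox.BadlyApproximable Φ) := by
  have hsuff := fun h : BadlyApprox.HasConstantNorm Φ ∧ BadlyApprox.HasMaximizingKernelFunction Φ =>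
    BadlyApprox.badlyApproximable_of_hasMaximizingKernelFunction h.1 h.2
  exact ⟨fun hess =>
    ⟨BadlyApprox.hasMaximizingKernelFunction_of_badlyApproximable hess, hsuff⟩, hsuff⟩
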